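/- For a permutation $\pi=\pi_1\pi_2\cdots\pi_n$ of $\{1,\dots,n\}$ let $D(\pi)=\sum_{i=1}^n|\pi_i-i|$, let $I(\pi)=|\{(i,j): i<j,\ \pi_i>\pi_j\}|$ be its inversion number, and let $T(\pi)=n-\mathrm{cyc}(\pi)$ be its reflection length, where $\mathrm{cyc}(\pi)$ is the number of cycles of $\pi$ (fixed points included). The permutation $\pi$ is *shallow* if $I(\pi)+T(\pi)=D(\pi)$. It *avoids 231* if there are no indices $i<j<k$ with $\pi_k<\pi_i<\pi_j$. Its reverse-complement $\pi^{rc}$ is defined by $\pi^{rc}_{n+1-i}=n+1-\pi_i$, and $\pi$ is *persymmetric* if $\pi=(\pi^{rc})^{-1}$. **Theorem.** For $n\ge 0$ let $p_n(231)$ be the number of shallow, 231-avoiding, persymmetric permutations of $\{1,\dots,n\}$ (so $p_0(231)=1$, counting the empty permutation), and let $P_{231}(x)=\sum_{n\ge 0}p_n(231)\,x^n$. Then, as formal power series, \[ P_{231}(x)=\frac{x^{10}+2x^8+x^7+x^6-x^5-2x^4+x^3+2x^2-x-1}{x^{10}+x^8+2x^6-4x^4+4x^2-1}. \] -/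

import Mathlib

/-! Permutations of length `n` are elements of `Equiv.Perm (Fin n)`: the one-line notation is
`π 0, π 1, …, π (n - 1)`, with positions and values shifted down by one from `{1, …, n}`. -/

namespace ShallowPerm

/-- The total displacement `D(π) = ∑ |π_i - i|`. -/
def totalDisplacement {n : ℕ} (π : Equiv.Perm (Fin n)) : ℤ :=
  ∑ i : Fin n, |((π i : ℕ) : ℤ) - ((i : ℕ) : ℤ)|

/-- The inversion number `I(π)`, the number of pairs `i < j` with `π_i > π_j`. -/
def inversionNumber {n : ℕ} (π : Equiv.Perm (Fin n)) : ℕ :=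
  ∑ i : Fin n, (Finset.univ.filter fun j : Fin n => i < j ∧ π j < π i).card

/-- The number of cycles in the disjoint cycle decomposition of `π`, fixed points included
(Mathlib's `cycleType` lists only the cycles of length at least two). -/
def cycleCount {n : ℕ} (π : Equiv.Perm (Fin n)) : ℕ :=
  π.cycleType.card + (Finset.univ.filter fun i : Fin n => π i = i).card

/-- The reflection length `T(π) = n - cyc(π)`. -/
def reflectionLength {n : ℕ} (π : Equiv.Perm (Fin n)) : ℤ :=
  (n : ℤ) - (cycleCount π : ℤ)

/-- `π` is shallow if `I(π) + T(π) = D(π)`. -/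
def IsShallow {n : ℕ} (π : Equiv.Perm (Fin n)) : Prop :=
  (inversionNumber π : ℤ) + reflectionLength π = totalDisplacement π

/-- `π` avoids 231: there are no positions `i < j < k` with `π_k < π_i < π_j`. -/
def Avoids231 {n : ℕ} (π : Equiv.Perm (Fin n)) : Prop :=
  ¬ ∃ i j k : Fin n, i < j ∧ j < k ∧ π k < π i ∧ π i < π j

/-- The reverse-complement: it sends `n + 1 - i` to `n + 1 - π_i`. -/
def reverseComplement {n : ℕ} (π : Equiv.Perm (Fin n)) : Equiv.Perm (Fin n) :=
  Fin.revPerm * π * Fin.revPerm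

/-- `π` is persymmetric if it equals the inverse of its reverse-complement. -/
def IsPersymmetric {n : ℕ} (π : Equiv.Perm (Fin n)) : Prop :=
  π = (reverseComplement π)⁻¹

/-- The number of shallow 231-avoiding persymmetric permutations of length `n`. -/
noncomputable def shallowPersymmetric231Count (n : ℕ) : ℕ :=
  Set.ncard {π : Equiv.Perm (Fin n) | IsShallow π ∧ Avoids231 π ∧ IsPersymmetric π}

/-- The ordinary generating function of these numbers, including the term `n = 0`. -/
noncomputable def shallowPersymmetric231GF : PowerSeries ℚ :=
  PowerSeries.mk fun n => (shallowPersymmetric231Count n : ℚ)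

end ShallowPerm

/-! The proof encodes 231-avoiding permutations by plane forests and finds the forests that give
shallow permutations. If a 231-avoiding permutation starts with `p`, then the next `p` entries are
exactly the smaller values. The permutation is therefore the direct sum of a block "`p`, then a
permutation of the smaller values" and a remainder. Recursively, this is a forest: the block is a
tree with its root, the remainder is the list of further trees (`Forest.val`, `exists_of_avoids`).

The defect `dft`, equal to `D - I - T`, is never negative (Diaconis–Graham, `dft_nonneg`), and
shallow means defect zero. It is additive over the trees of a forest. It is also additive over the
children of a root (`defect_append_child`): the tree over a concatenation is a product of two
permutations whose supports share at most one point, and reflection length adds up for such products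
(`rl_mul`). Hence shallowness need only be decided for a root with one child.

For such a tree, deleting `0` and the maximum from their cycles changes the defect by an explicit
nonnegative cost. Vanishing of that cost forces the forest below the child to be a path, or a stem
carrying two paths (`eq_chain_or_fork`). The same deletion gives a recursion that settles which
forks are shallow: one of the three parameters must vanish (`defect_fork_eq_zero_iff`). These
branches are the limbs, so a shallow forest is a list of lists of limbs.

The inverse of the reverse-complement corresponds to the mirror image (`val_mirror`). The objects to
count are thus palindromic lists of trees, where reversal also mirrors each tree. Let `C` count
limbs in the variable `x²` and `E` count mirror-symmetric limbs in `x`. Trees in `x²` have series `A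
= x²/(1 - C)`, symmetric trees have `Q = x(1 + E)/(1 - C)`, and the answer is `P = (1 + Q)/(1 - A)`.
-/

namespace ShallowPerm

/-! ### Reflection length: deleting a point, gluing at a point -/

section ReflectionLength

open Equiv Equiv.Perm

variable {α β : Type*} [Fintype α] [DecidableEq α] [Fintype β] [DecidableEq β]

/-- The reflection length of a permutation of a finite type. -/
def rl (f : Perm α) : ℤ := (f.support.card : ℤ) - (f.cycleType.card : ℤ)

theorem rl_mul_of_disjoint {f g : Perm α} (h : Perm.Disjoint f g) : rl (f * g) = rl f + rl g := by
  unfold rl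
  rw [h.cycleType_mul, h.card_support_mul]
  push_cast [Multiset.card_add]
  ring

theorem rl_one : rl (1 : Perm α) = 0 := by simp [rl]

theorem rl_of_isCycle {f : Perm α} (h : IsCycle f) : rl f = (f.support.card : ℤ) - 1 := by
  simp [rl, h.cycleType]

/-- Removing a moved point from its cycle lowers the reflection length by one. -/
theorem rl_swap_mul {f : Perm α} {x : α} (hx : f x ≠ x) : rl f = rl (swap x (f x) * f) + 1 := by
  set c := f.cycleOf x with hc
  have hcyc : IsCycle c := isCycle_cycleOf f hx
  have hcx : c x = f x := cycleOf_apply_self f x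
  have hmem : c ∈ f.cycleFactorsFinset :=
    cycleOf_mem_cycleFactorsFinset_iff.2 (mem_support.2 hx)
  set d := f * c⁻¹ with hd
  have hdisj : Perm.Disjoint c d := (disjoint_mul_inv_of_mem_cycleFactorsFinset hmem).symm
  have hf : f = c * d := by rw [hdisj.commute.eq, hd]; simp
  have hg : swap x (f x) * f = (swap x (c x) * c) * d := by
    rw [hcx, mul_assoc, ← hf]
  rw [hg]
  conv_lhs => rw [hf]
  rw [rl_mul_of_disjoint hdisj]
  have hcxx : c x ≠ x := hcx ▸ hx
  -- A two-cycle is cancelled by the swap. A longer cycle stays a cycle, on its support without `x`.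
  by_cases h2 : c (c x) = x
  · have hsw : c = swap x (c x) := hcyc.eq_swap_of_apply_apply_eq_self hcxx h2
    have h1 : swap x (c x) * c = 1 := by
      conv_lhs => rw [hsw]
      simp
    have h3 : rl c = 1 := by
      rw [rl_of_isCycle hcyc, hsw, card_support_swap (Ne.symm hcxx)]
      norm_num
    rw [h1, one_mul, h3]
    ring
  · have hs := support_swap_mul_eq c x h2
    have hdisj2 : Perm.Disjoint (swap x (c x) * c) d := by
      rw [disjoint_iff_disjoint_support] at hdisj ⊢
      refine Finset.disjoint_of_subset_left ?_ hdisj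
      rw [hs]
      exact Finset.sdiff_subset
    rw [rl_mul_of_disjoint hdisj2, rl_of_isCycle hcyc, rl_of_isCycle (hcyc.swap_mul hcxx h2), hs,
      Finset.card_sdiff_of_subset (by simpa using hcxx), Finset.card_singleton]
    have : 1 ≤ c.support.card := by
      have := hcyc.two_le_card_support
      omega
    push_cast [this]
    ring

/-- Induction on the support of `g`, with `k` as a bound so that `g` can vary. Some point moved by
`g` is fixed by `f`; deleting it from its cycle lowers the reflection lengths of `g` and of `f * g`
by one each. -/
theorem rl_mul_of_support_inter (f : Perm α) (k : ℕ) : ∀ g : Perm α, g.support.card ≤ k →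
    (∀ x y, f x ≠ x → g x ≠ x → f y ≠ y → g y ≠ y → x = y) → rl (f * g) = rl f + rl g := by
  induction k with
  | zero =>
    intro g hg _
    have : g = 1 := by
      rw [← support_eq_empty_iff]
      exact Finset.card_eq_zero.1 (Nat.le_zero.1 hg)
    simp [this, rl_one]
  | succ k ih =>
    intro g hg h
    by_cases hg1 : g = 1
    · simp [hg1, rl_one]
    obtain ⟨x, hgx, hfx⟩ : ∃ x, g x ≠ x ∧ f x = x := by
      -- If `f` moved every point that `g` moves, then `y` and `g y` would be two distinct common
      -- points.
      by_contra! hcon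
      obtain ⟨y, hy⟩ : ∃ y, g y ≠ y := by
        by_contra! h'
        exact hg1 (Equiv.ext h')
      have hgy : g (g y) ≠ g y := fun h' => hy (g.injective h')
      exact hy (h (g y) y (hcon _ hgy) hgy (hcon _ hy) hy)
    have hinv : g (g⁻¹ x) = x := by simp
    have hginv : g⁻¹ x ≠ x := fun h' => hgx (by rw [h'] at hinv; exact hinv)
    set y := g⁻¹ x with hy
    have hfgx : (f * g) x ≠ x := by
      intro h'
      apply hgx
      apply f.injective
      rw [hfx]; exact h'
    set g' := swap x (g x) * g with hg'
    -- Since `f` fixes `x`, conjugating the swap of `x` and `g x` by `f` gives the swap of `x` and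
    -- `f (g x)`.
    have hmul : swap x ((f * g) x) * (f * g) = f * g' := by
      have : f * swap x (g x) = swap (f x) (f (g x)) * f := by
        rw [Equiv.mul_swap_eq_swap_mul]
      rw [hg', ← mul_assoc, ← mul_assoc, this, hfx]
      rfl
    rw [rl_swap_mul hfgx, hmul, rl_swap_mul hgx]
    have hlt : g'.support.card < g.support.card := card_support_swap_mul hgx
    have hsub : ∀ z, g' z ≠ z → g z ≠ z := fun z hz => (ne_and_ne_of_swap_mul_apply_ne_self hz).1
    rw [ih g' (by omega) fun a b ha hb hc hd => h a b ha (hsub _ hb) hc (hsub _ hd)]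
    ring

theorem rl_mul {f g : Perm α}
    (h : ∀ x y, f x ≠ x → g x ≠ x → f y ≠ y → g y ≠ y → x = y) : rl (f * g) = rl f + rl g :=
  rl_mul_of_support_inter f _ g le_rfl h

/-- Extension by the identity makes permutations of different index sets comparable without changing
the reflection length. -/
theorem exists_extension (σ : Perm α) (φ : α ↪ β) :
    ∃ π : Perm β, rl π = rl σ ∧ (∀ a, π (φ a) = φ (σ a)) ∧ ∀ b, (∀ a, φ a ≠ b) → π b = b := by
  classical
  let e : α ≃ {b // b ∈ Set.range φ} := Equiv.ofInjective φ φ.injective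
  refine ⟨σ.extendDomain e, ?_, fun a => ?_, fun b hb => ?_⟩
  · unfold rl
    rw [cycleType_extendDomain, card_support_extend_domain]
  · exact Perm.extendDomain_apply_image σ e a
  · apply Perm.extendDomain_apply_not_subtype
    rintro ⟨a, ha⟩
    exact hb a ha

/-- A permutation that restricts to `σ` after `x` is removed from its cycle. -/
theorem rl_remove {σ : Perm α} {π : Perm β} (φ : α ↪ β) (x : β) (hx : π x ≠ x)
    (hφ : ∀ b, (∀ a, φ a ≠ b) ↔ b = x)
    (h : ∀ a, φ (σ a) = if π (φ a) = x then π x else π (φ a)) : rl π = rl σ + 1 := by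
  obtain ⟨τ, hτ, h1, h2⟩ := exists_extension σ φ
  rw [rl_swap_mul hx, ← hτ]
  congr 2
  ext b
  by_cases hb : b = x
  · subst hb
    rw [h2 b ((hφ b).2 rfl)]
    simp
  · have : ∃ a, φ a = b := by
      by_contra! h'
      exact hb ((hφ b).1 h')
    obtain ⟨a, rfl⟩ := this
    rw [h1, h]
    split_ifs with hc
    · simp [hc]
    · rw [Perm.mul_apply, swap_apply_of_ne_of_ne hc]
      intro h'
      exact hb (π.injective h')

/-- The reflection length is additive when two permutations are glued at one common point. -/
theorem rl_glue {γ : Type*} [Fintype γ] [DecidableEq γ] {σ : Perm α} {τ : Perm β} {π : Perm γ}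
    (φ : α ↪ γ) (ψ : β ↪ γ) (hcap : ∀ a b a' b', φ a = ψ b → φ a' = ψ b' → φ a = φ a')
    (hcov : ∀ c, (∃ a, φ a = c) ∨ ∃ b, ψ b = c)
    (h1 : ∀ a, (∀ b, ψ b ≠ φ (σ a)) → π (φ a) = φ (σ a))
    (h2 : ∀ a b, ψ b = φ (σ a) → π (φ a) = ψ (τ b))
    (h3 : ∀ b, (∀ a, φ a ≠ ψ b) → π (ψ b) = ψ (τ b)) : rl π = rl σ + rl τ := by
  obtain ⟨f, hf, f1, f2⟩ := exists_extension σ φ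
  obtain ⟨g, hg, g1, g2⟩ := exists_extension τ ψ
  -- The hypotheses say that `π` applies `σ` on its part first, then `τ`. The two extensions move at
  -- most one common point, so `rl_mul` applies.
  have key : π = g * f := by
    ext c
    rw [Perm.mul_apply]
    by_cases hc : ∃ a, φ a = c
    · obtain ⟨a, rfl⟩ := hc
      rw [f1]
      by_cases hb : ∃ b, ψ b = φ (σ a)
      · obtain ⟨b, hb⟩ := hb
        rw [h2 a b hb, ← hb, g1]
      · push Not at hb
        rw [h1 a hb, g2 _ hb]
    · push Not at hc
      rw [f2 c hc]
      obtain ⟨a, ha⟩ | ⟨b, rfl⟩ := hcov c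
      · exact absurd ha (hc a)
      rw [g1, h3 b hc]
  rw [key, rl_mul, hf, hg, add_comm]
  have hz : ∀ x, g x ≠ x → f x ≠ x → (∃ a, φ a = x) ∧ ∃ b, ψ b = x := by
    intro x hgx hfx
    constructor
    · by_contra! h
      exact hfx (f2 x h)
    · by_contra! h
      exact hgx (g2 x h)
  intro x y hx1 hx2 hy1 hy2
  obtain ⟨⟨a, ha⟩, ⟨b, hb⟩⟩ := hz x hx1 hx2
  obtain ⟨⟨a', ha'⟩, ⟨b', hb'⟩⟩ := hz y hy1 hy2
  rw [← ha, ← ha']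
  exact hcap a b a' b' (by rw [ha, hb]) (by rw [ha', hb'])

theorem reflectionLength_eq_rl {n : ℕ} (π : Perm (Fin n)) : reflectionLength π = rl π := by
  unfold reflectionLength cycleCount rl
  have h : (Finset.univ.filter fun i : Fin n => π i = i).card + π.support.card = n := by
    have := Finset.card_filter_add_card_filter_not (s := (Finset.univ : Finset (Fin n)))
      (p := fun i => π i = i)
    simpa [support] using this
  push_cast
  have h' : ((Finset.univ.filter fun i : Fin n => π i = i).card : ℤ) + π.support.card = n := by
    exact_mod_cast h
  linarith

end ReflectionLength

end ShallowPerm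

/-! ### The defect, and deletion of the minimum or maximum from its cycle -/

namespace ShallowPerm

open Finset

/-- `f` restricts to a permutation of `{0, …, n - 1}`. -/
def IsPerm (n : ℕ) (f : ℕ → ℕ) : Prop :=
  (∀ i < n, f i < n) ∧ ∀ i < n, ∀ j < n, f i = f j → i = j

/-- The permutation of `Fin n` given by a function that permutes `{0, …, n - 1}`. -/
noncomputable def IsPerm.toPerm {n : ℕ} {f : ℕ → ℕ} (h : IsPerm n f) : Equiv.Perm (Fin n) :=
  Equiv.ofBijective (fun i => ⟨f i, h.1 i i.2⟩) <| Finite.injective_iff_bijective.1 fun i j hij =>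
    Fin.ext (h.2 i i.2 j j.2 (by simpa using hij))

@[simp]
theorem IsPerm.toPerm_val {n : ℕ} {f : ℕ → ℕ} (h : IsPerm n f) (i : Fin n) :
    (h.toPerm i : ℕ) = f i := rfl

theorem IsPerm.exists_eq {n : ℕ} {f : ℕ → ℕ} (h : IsPerm n f) {v : ℕ} (hv : v < n) :
    ∃ i < n, f i = v := by
  obtain ⟨i, hi⟩ := h.toPerm.surjective ⟨v, hv⟩
  exact ⟨i, i.2, by rw [← h.toPerm_val, hi]⟩

theorem IsPerm.congr {n : ℕ} {f g : ℕ → ℕ} (h : IsPerm n f) (hfg : ∀ i < n, f i = g i) :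
    IsPerm n g := by
  refine ⟨fun i hi => hfg i hi ▸ h.1 i hi, fun i hi j hj hij => h.2 i hi j hj ?_⟩
  rw [hfg i hi, hfg j hj, hij]

theorem IsPerm.sum_comp {n : ℕ} {f : ℕ → ℕ} (h : IsPerm n f) (F : ℕ → ℤ) :
    ∑ i ∈ range n, F (f i) = ∑ i ∈ range n, F i := by
  rw [Finset.sum_range fun i => F (f i), Finset.sum_range,
    ← Equiv.sum_comp h.toPerm fun i => F i]
  rfl

theorem sum_ite_lt (n v : ℕ) (hv : v ≤ n) :
    ∑ i ∈ range n, (if i < v then (1 : ℤ) else 0) = v := by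
  rw [← Finset.sum_filter, Finset.sum_const, nsmul_eq_mul, mul_one]
  have : (range n).filter (fun i => i < v) = range v := by
    ext i; simp; omega
  rw [this, card_range]

theorem sum_ite_gt (n v : ℕ) (hv : v < n) :
    ∑ i ∈ range n, (if v < i then (1 : ℤ) else 0) = n - 1 - v := by
  have h : ∀ i ∈ range n, (if v < i then (1 : ℤ) else 0) = 1 - if i < v + 1 then (1 : ℤ) else 0 := by
    intro i _
    split_ifs <;> omega
  rw [sum_congr rfl h, sum_sub_distrib, sum_ite_lt n (v + 1) hv]
  simp
  ring

/-- The reflection length of the permutation of `{0, …, n - 1}` given by `f`. -/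
noncomputable def rlFun (n : ℕ) (f : ℕ → ℕ) : ℤ :=
  open Classical in if h : IsPerm n f then rl h.toPerm else 0

theorem rlFun_eq {n : ℕ} {f : ℕ → ℕ} (h : IsPerm n f) : rlFun n f = rl h.toPerm := dif_pos h

/-- The total displacement of `f` on `{0, …, n - 1}`. -/
def disp (n : ℕ) (f : ℕ → ℕ) : ℤ := ∑ i ∈ range n, |(f i : ℤ) - i|

/-- The inversion number of `f` on `{0, …, n - 1}`. -/
def inv (n : ℕ) (f : ℕ → ℕ) : ℤ :=
  ∑ i ∈ range n, ∑ j ∈ range n, if i < j ∧ f j < f i then 1 else 0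

/-- The failure of shallowness. -/
noncomputable def dft (n : ℕ) (f : ℕ → ℕ) : ℤ := disp n f - inv n f - rlFun n f

theorem rlFun_congr {n : ℕ} {f g : ℕ → ℕ} (h : ∀ i < n, f i = g i) : rlFun n f = rlFun n g := by
  by_cases hf : IsPerm n f
  · have hg := hf.congr h
    rw [rlFun_eq hf, rlFun_eq hg]
    congr 1
    ext i
    simp [h i i.2]
  · have hg : ¬ IsPerm n g := fun hg => hf (hg.congr fun i hi => (h i hi).symm)
    rw [rlFun, rlFun, dif_neg hf, dif_neg hg]

theorem dft_congr {n : ℕ} {f g : ℕ → ℕ} (h : ∀ i < n, f i = g i) : dft n f = dft n g := by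
  unfold dft disp inv
  rw [rlFun_congr h]
  congr 2
  · exact sum_congr rfl fun i hi => by rw [h i (mem_range.1 hi)]
  · exact sum_congr rfl fun i hi => sum_congr rfl fun j hj => by
      rw [h i (mem_range.1 hi), h j (mem_range.1 hj)]

theorem inv_succ_left (n : ℕ) (f : ℕ → ℕ) :
    inv (n + 1) f = (∑ j ∈ range n, if f (j + 1) < f 0 then 1 else 0) +
      inv n (fun i => f (i + 1)) := by
  unfold inv
  rw [sum_range_succ', add_comm]
  congr 1
  · rw [sum_range_succ']
    simp
  · refine sum_congr rfl fun i _ => ?_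
    rw [sum_range_succ']
    simp

theorem inv_succ_right (n : ℕ) (f : ℕ → ℕ) :
    inv (n + 1) f = inv n f + ∑ i ∈ range n, if f n < f i then 1 else 0 := by
  unfold inv
  rw [sum_range_succ]
  have h0 : ∑ j ∈ range (n + 1), (if n < j ∧ f j < f n then (1 : ℤ) else 0) = 0 := by
    refine sum_eq_zero fun j hj => if_neg ?_
    have := mem_range.1 hj
    omega
  rw [h0, add_zero, ← sum_add_distrib]
  refine sum_congr rfl fun i hi => ?_
  rw [sum_range_succ]
  have := mem_range.1 hi
  simp [this]

/-- The contribution to the inversion number of the pair formed by `i` and `q`. -/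
def invAt (f : ℕ → ℕ) (q i : ℕ) : ℤ :=
  (if i < q ∧ f q < f i then 1 else 0) + if q < i ∧ f i < f q then 1 else 0

/-- Inversions that avoid position `q` depend only on the relative order off `q`, which `f` and `g`
share. -/
theorem inv_compare {n q : ℕ} (hq : q < n) {f g : ℕ → ℕ}
    (h : ∀ i < n, ∀ j < n, i ≠ q → j ≠ q → (f j < f i ↔ g j < g i)) :
    inv n f - ∑ i ∈ range n, invAt f q i = inv n g - ∑ i ∈ range n, invAt g q i := by
  have key : ∀ f : ℕ → ℕ, inv n f - ∑ i ∈ range n, invAt f q i =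
      ∑ i ∈ range n, ∑ j ∈ range n,
        if i ≠ q ∧ j ≠ q ∧ i < j ∧ f j < f i then (1 : ℤ) else 0 := by
    intro f
    have : ∀ i ∈ range n, ∀ j ∈ range n, (if i < j ∧ f j < f i then (1 : ℤ) else 0) =
        (if i ≠ q ∧ j ≠ q ∧ i < j ∧ f j < f i then (1 : ℤ) else 0) +
        (if j = q then (if i < q ∧ f q < f i then 1 else 0) else 0) +
        (if i = q then (if q < j ∧ f j < f q then 1 else 0) else 0) := by
      intro i _ j _
      by_cases hi : i = q <;> by_cases hj : j = q <;> simp [hi, hj]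
    unfold inv invAt
    rw [sum_congr rfl fun i hi => sum_congr rfl (this i hi)]
    simp only [sum_add_distrib, sum_ite_eq', mem_range, hq, if_true]
    rw [sum_comm (s := range n) (t := range n)
      (f := fun i j => if i = q then (if q < j ∧ f j < f q then (1 : ℤ) else 0) else 0)]
    simp only [sum_ite_eq', mem_range, hq, if_true]
    ring
  rw [key, key]
  refine sum_congr rfl fun i hi => sum_congr rfl fun j hj => ?_
  by_cases hiq : i = q
  · simp [hiq]
  by_cases hjq : j = q
  · simp [hjq]
  simp [h i (mem_range.1 hi) j (mem_range.1 hj) hiq hjq]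

theorem IsPerm.sum_lt {n : ℕ} {e : ℕ → ℕ} (he : IsPerm n e) {v : ℕ} (hv : v ≤ n) :
    ∑ i ∈ range n, (if e i < v then (1 : ℤ) else 0) = v := by
  rw [he.sum_comp fun x => if x < v then (1 : ℤ) else 0, sum_ite_lt n v hv]

theorem IsPerm.sum_gt {n : ℕ} {e : ℕ → ℕ} (he : IsPerm n e) {v : ℕ} (hv : v < n) :
    ∑ i ∈ range n, (if v < e i then (1 : ℤ) else 0) = n - 1 - v := by
  rw [he.sum_comp fun x => if v < x then (1 : ℤ) else 0, sum_ite_gt n v hv]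

/-- Position `i` forms an inversion with `q` when exactly one of `i < q` and `e i < e q` holds, so
the count is the size of a symmetric difference. -/
theorem IsPerm.sum_invAt_left {n q : ℕ} (hq : q < n) {e : ℕ → ℕ} (he : IsPerm n e) :
    ∑ i ∈ range n, invAt e q i =
      q + e q - 2 * ∑ i ∈ range n, if i < q ∧ e i < e q then (1 : ℤ) else 0 := by
  have h : ∀ i ∈ range n, invAt e q i = (if i < q then (1 : ℤ) else 0) +
      (if e i < e q then (1 : ℤ) else 0) - 2 * if i < q ∧ e i < e q then (1 : ℤ) else 0 := by
    intro i hi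
    unfold invAt
    have := he.2 i (mem_range.1 hi) q hq
    rcases lt_trichotomy i q with h1 | h1 | h1
    · rcases lt_trichotomy (e i) (e q) with h2 | h2 | h2
      · simp [h1, h2, h1.not_gt, h2.not_gt]
      · omega
      · simp [h1, h2, h1.not_gt, h2.not_gt]
    · simp [h1]
    · simp [h1, h1.not_gt]
  rw [sum_congr rfl h, sum_sub_distrib, sum_add_distrib, he.sum_lt (he.1 q hq).le,
    sum_ite_lt n q hq.le, ← mul_sum]

/-- The same symmetric difference, written with the complementary conditions `q < i` and `e q < e
i`. -/
theorem IsPerm.sum_invAt_right {n q : ℕ} (hq : q < n) {e : ℕ → ℕ} (he : IsPerm n e) :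
    ∑ i ∈ range n, invAt e q i = (n - 1 - q) + (n - 1 - e q) -
      2 * ∑ i ∈ range n, if q < i ∧ e q < e i then (1 : ℤ) else 0 := by
  have h : ∀ i ∈ range n, invAt e q i = (if q < i then (1 : ℤ) else 0) +
      (if e q < e i then (1 : ℤ) else 0) - 2 * if q < i ∧ e q < e i then (1 : ℤ) else 0 := by
    intro i hi
    unfold invAt
    have := he.2 i (mem_range.1 hi) q hq
    rcases lt_trichotomy i q with h1 | h1 | h1
    · simp [h1, h1.not_gt]
    · simp [h1]
    · rcases lt_trichotomy (e i) (e q) with h2 | h2 | h2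
      · simp [h1, h2, h1.not_gt, h2.not_gt]
      · omega
      · simp [h1, h2, h1.not_gt, h2.not_gt]
  rw [sum_congr rfl h, sum_sub_distrib, sum_add_distrib, he.sum_gt (he.1 q hq),
    sum_ite_gt n q hq, ← mul_sum]

/-- Removing `0` from its cycle. -/
theorem dft_remove_zero {n q : ℕ} (hq : q < n) {f e : ℕ → ℕ} (hf : IsPerm (n + 1) f)
    (he : IsPerm n e) (h0 : f 0 = e q + 1) (h1 : f (q + 1) = 0)
    (h2 : ∀ i < n, i ≠ q → f (i + 1) = e i + 1) :
    dft (n + 1) f = dft n e +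
      2 * (min q (e q) - ∑ i ∈ range n, if i < q ∧ e i < e q then (1 : ℤ) else 0) := by
  have hinv : inv (n + 1) f = inv n e + 1 +
      2 * ∑ i ∈ range n, if i < q ∧ e i < e q then (1 : ℤ) else 0 := by
    rw [inv_succ_left]
    have hs : ∑ j ∈ range n, (if f (j + 1) < f 0 then (1 : ℤ) else 0) = e q + 1 := by
      have : ∀ j ∈ range n, (if f (j + 1) < f 0 then (1 : ℤ) else 0) =
          (if e j < e q then (1 : ℤ) else 0) + if j = q then 1 else 0 := by
        intro j hj
        by_cases hjq : j = q
        · subst hjq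
          simp [h0, h1]
        · simp [h0, h2 j (mem_range.1 hj) hjq, hjq]
      rw [sum_congr rfl this, sum_add_distrib, he.sum_lt (he.1 q hq).le]
      simp [hq]
    have hc := inv_compare hq (f := fun i => f (i + 1)) (g := e) (by
      intro i hi j hj hiq hjq
      simp only [h2 i hi hiq, h2 j hj hjq]
      omega)
    -- The value `0` sits at `q`, so it is inverted with every earlier position and no later one.
    have hg : ∑ i ∈ range n, invAt (fun i => f (i + 1)) q i = q := by
      rw [← sum_ite_lt n q hq.le]
      refine sum_congr rfl fun i hi => ?_
      unfold invAt
      simp only [h1]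
      by_cases hiq : i < q
      · simp [hiq, h2 i (mem_range.1 hi) hiq.ne]
      · simp [hiq]
    rw [hg, he.sum_invAt_left hq] at hc
    rw [hs]
    linarith
  have hdisp : disp (n + 1) f = disp n e + 2 + 2 * min q (e q) := by
    unfold disp
    rw [sum_range_succ']
    have : ∀ i ∈ range n, |((f (i + 1) : ℕ) : ℤ) - ((i + 1 : ℕ) : ℤ)| =
        |(e i : ℤ) - i| + if i = q then (q + 1 - |(e q : ℤ) - q|) else 0 := by
      intro i hi
      by_cases hiq : i = q
      · subst hiq
        rw [h1, if_pos rfl]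
        push_cast
        rw [zero_sub, abs_neg, abs_of_nonneg (by positivity)]
        ring
      · rw [h2 i (mem_range.1 hi) hiq, if_neg hiq]
        push_cast
        rw [add_zero]
        congr 1
        ring
    rw [sum_congr rfl this, sum_add_distrib, h0]
    simp only [sum_ite_eq', mem_range, hq, if_true]
    push_cast
    rcases le_total (e q) q with h | h
    · have h' : (e q : ℤ) ≤ q := by exact_mod_cast h
      rw [min_eq_right h', abs_of_nonpos (by linarith), abs_of_nonneg (by linarith)]
      ring
    · have h' : (q : ℤ) ≤ e q := by exact_mod_cast h
      rw [min_eq_left h', abs_of_nonneg (by linarith), abs_of_nonneg (by linarith)]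
      ring
  have hrl : rlFun (n + 1) f = rlFun n e + 1 := by
    rw [rlFun_eq hf, rlFun_eq he]
    refine rl_remove (Fin.succEmb n) 0 ?_ ?_ ?_
    · rw [Ne, Fin.ext_iff]
      simp [h0]
    · intro b
      refine ⟨fun h => ?_, ?_⟩
      · by_contra hb
        obtain ⟨c, rfl⟩ := Fin.exists_succ_eq.2 hb
        exact h c rfl
      · rintro rfl a
        simp
    · intro a
      by_cases ha : (a : ℕ) = q
      · have : hf.toPerm ((Fin.succEmb n) a) = 0 := by
          ext
          simp [ha, h1]
        rw [if_pos this]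
        ext
        simp [ha, h0]
      · have : (hf.toPerm ((Fin.succEmb n) a) : ℕ) = e a + 1 := by
          simp [h2 a a.2 ha]
        rw [if_neg]
        · ext
          rw [this]
          simp
        · intro h
          rw [h] at this
          simp at this
  unfold dft
  rw [hinv, hdisp, hrl]
  ring

/-- Removing the maximum from its cycle. -/
theorem dft_remove_last {n q : ℕ} (hq : q < n) {f e : ℕ → ℕ} (hf : IsPerm (n + 1) f)
    (he : IsPerm n e) (h0 : f n = e q) (h1 : f q = n)
    (h2 : ∀ i < n, i ≠ q → f i = e i) :
    dft (n + 1) f = dft n e +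
      2 * (n - 1 - max q (e q) - ∑ i ∈ range n, if q < i ∧ e q < e i then (1 : ℤ) else 0) := by
  have heq := he.1 q hq
  have hinv : inv (n + 1) f = inv n e + 1 +
      2 * ∑ i ∈ range n, if q < i ∧ e q < e i then (1 : ℤ) else 0 := by
    rw [inv_succ_right]
    have hs : ∑ i ∈ range n, (if f n < f i then (1 : ℤ) else 0) = n - e q := by
      have : ∀ j ∈ range n, (if f n < f j then (1 : ℤ) else 0) =
          (if e q < e j then (1 : ℤ) else 0) + if j = q then 1 else 0 := by
        intro j hj
        by_cases hjq : j = q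
        · subst hjq
          simp [h0, h1, heq]
        · simp [h0, h2 j (mem_range.1 hj) hjq, hjq]
      rw [sum_congr rfl this, sum_add_distrib, he.sum_gt heq]
      simp [hq]
      ring
    have hc := inv_compare hq (f := f) (g := e) (by
      intro i hi j hj hiq hjq
      rw [h2 i hi hiq, h2 j hj hjq])
    -- The maximum sits at `q`, so it is inverted with every later position and no earlier one.
    have hg : ∑ i ∈ range n, invAt f q i = n - 1 - q := by
      rw [← sum_ite_gt n q hq]
      refine sum_congr rfl fun i hi => ?_
      unfold invAt
      simp only [h1]
      have hin := mem_range.1 hi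
      rcases lt_trichotomy i q with hiq | hiq | hiq
      · have := he.1 i hin
        simp [hiq.not_gt, h2 i hin hiq.ne, this.not_gt]
      · simp [hiq]
      · have := he.1 i hin
        simp [hiq, hiq.not_gt, h2 i hin hiq.ne', this]
    rw [hg, he.sum_invAt_right hq] at hc
    rw [hs]
    linarith
  have hdisp : disp (n + 1) f = disp n e + 2 * (n - max q (e q)) := by
    unfold disp
    rw [sum_range_succ]
    have : ∀ i ∈ range n, |(f i : ℤ) - i| =
        |(e i : ℤ) - i| + if i = q then (n - q - |(e q : ℤ) - q|) else 0 := by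
      intro i hi
      by_cases hiq : i = q
      · subst hiq
        rw [h1, if_pos rfl, abs_of_nonneg (a := (n : ℤ) - i) (by linarith)]
        ring
      · rw [h2 i (mem_range.1 hi) hiq, if_neg hiq, add_zero]
    rw [sum_congr rfl this, sum_add_distrib, h0]
    simp only [sum_ite_eq', mem_range, hq, if_true]
    rw [abs_of_nonpos (a := (e q : ℤ) - n) (by linarith)]
    push_cast
    rcases le_total (e q) q with h | h
    · have h' : (e q : ℤ) ≤ q := by exact_mod_cast h
      rw [max_eq_left h', abs_of_nonpos (by linarith)]
      ring
    · have h' : (q : ℤ) ≤ e q := by exact_mod_cast h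
      rw [max_eq_right h', abs_of_nonneg (by linarith)]
      ring
  have hrl : rlFun (n + 1) f = rlFun n e + 1 := by
    rw [rlFun_eq hf, rlFun_eq he]
    have hlast : (hf.toPerm (Fin.last n) : ℕ) = e q := by simp [h0]
    refine rl_remove (Fin.castSuccEmb (n := n)) (Fin.last n) ?_ ?_ ?_
    · rw [Ne, Fin.ext_iff, hlast]
      simp
      omega
    · intro b
      refine ⟨fun h => ?_, ?_⟩
      · by_contra hb
        obtain ⟨c, rfl⟩ := Fin.exists_castSucc_eq.2 hb
        exact h c rfl
      · rintro rfl a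
        exact Fin.castSucc_ne_last a
    · intro a
      by_cases ha : (a : ℕ) = q
      · have : hf.toPerm ((Fin.castSuccEmb (n := n)) a) = Fin.last n := by
          ext
          simp [ha, h1]
        rw [if_pos this]
        ext
        rw [hlast]
        simp [ha]
      · have : (hf.toPerm ((Fin.castSuccEmb (n := n)) a) : ℕ) = e a := by
          simp [h2 a a.2 ha]
        rw [if_neg]
        · ext
          rw [this]
          simp
        · intro h
          rw [h] at this
          have := he.1 a a.2
          simp at *
          omega
  unfold dft
  rw [hinv, hdisp, hrl]
  ring

end ShallowPerm

/-! ### Direct sums, a new leading maximum, and the Diaconis–Graham inequality -/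

namespace ShallowPerm

open Finset

/-- The direct sum of permutations, in one-line notation. -/
def dsum (m : ℕ) (f g : ℕ → ℕ) : ℕ → ℕ := fun i => if i < m then f i else m + g (i - m)

/-- The permutation with first entry `m` followed by the entries of `f`. -/
def top (m : ℕ) (f : ℕ → ℕ) : ℕ → ℕ := fun i => if i = 0 then m else f (i - 1)

theorem dsum_of_lt {m i : ℕ} (f g : ℕ → ℕ) (h : i < m) : dsum m f g i = f i := if_pos h

theorem dsum_add (m i : ℕ) (f g : ℕ → ℕ) : dsum m f g (m + i) = m + g i := by simp [dsum]

@[simp] theorem top_zero (m : ℕ) (f : ℕ → ℕ) : top m f 0 = m := rfl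

@[simp] theorem top_succ (m i : ℕ) (f : ℕ → ℕ) : top m f (i + 1) = f i := rfl

theorem IsPerm.dsum {m n : ℕ} {f g : ℕ → ℕ} (hf : IsPerm m f) (hg : IsPerm n g) :
    IsPerm (m + n) (dsum m f g) := by
  constructor
  · intro i hi
    unfold ShallowPerm.dsum
    split_ifs with h
    · have := hf.1 i h
      omega
    · have := hg.1 (i - m) (by omega)
      omega
  · intro i hi j hj
    unfold ShallowPerm.dsum
    split_ifs with h1 h2 h2
    · exact hf.2 i h1 j h2
    · have := hf.1 i h1
      omega
    · have := hf.1 j h2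
      omega
    · intro h
      have := hg.2 (i - m) (by omega) (j - m) (by omega) (by omega)
      omega

theorem IsPerm.top {m : ℕ} {f : ℕ → ℕ} (hf : IsPerm m f) : IsPerm (m + 1) (top m f) := by
  constructor
  · rintro (_ | i) hi
    · simp
    · have := hf.1 i (by omega)
      simp only [top_succ]
      omega
  · rintro (_ | i) hi (_ | j) hj h
    · rfl
    · have := hf.1 j (by omega)
      simp only [top_zero, top_succ] at h
      omega
    · have := hf.1 i (by omega)
      simp only [top_zero, top_succ] at h
      omega
    · have := hf.2 i (by omega) j (by omega) (by simpa using h)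
      omega

theorem disp_dsum (m n : ℕ) (f g : ℕ → ℕ) :
    disp (m + n) (dsum m f g) = disp m f + disp n g := by
  unfold disp
  rw [sum_range_add]
  congr 1
  · exact sum_congr rfl fun i hi => by rw [dsum_of_lt _ _ (mem_range.1 hi)]
  · refine sum_congr rfl fun i _ => ?_
    rw [dsum_add]
    push_cast
    congr 1
    ring

theorem inv_dsum {m n : ℕ} {f g : ℕ → ℕ} (hf : IsPerm m f) :
    inv (m + n) (dsum m f g) = inv m f + inv n g := by
  unfold inv
  rw [sum_range_add]
  congr 1
  · refine sum_congr rfl fun i hi => ?_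
    rw [sum_range_add]
    have hi := mem_range.1 hi
    have h0 : ∑ j ∈ range n, (if i < m + j ∧ dsum m f g (m + j) < dsum m f g i then (1 : ℤ)
        else 0) = 0 := by
      refine sum_eq_zero fun j _ => if_neg ?_
      rw [dsum_add, dsum_of_lt _ _ hi]
      have := hf.1 i hi
      omega
    rw [h0, add_zero]
    exact sum_congr rfl fun j hj => by
      rw [dsum_of_lt _ _ hi, dsum_of_lt _ _ (mem_range.1 hj)]
  · refine sum_congr rfl fun i _ => ?_
    rw [sum_range_add]
    have h0 : ∑ j ∈ range m, (if m + i < j ∧ dsum m f g j < dsum m f g (m + i) then (1 : ℤ)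
        else 0) = 0 := by
      refine sum_eq_zero fun j hj => if_neg ?_
      have := mem_range.1 hj
      omega
    rw [h0, zero_add]
    exact sum_congr rfl fun j _ => by simp [dsum_add]

theorem rlFun_dsum {m n : ℕ} {f g : ℕ → ℕ} (hf : IsPerm m f) (hg : IsPerm n g) :
    rlFun (m + n) (dsum m f g) = rlFun m f + rlFun n g := by
  rw [rlFun_eq (hf.dsum hg), rlFun_eq hf, rlFun_eq hg]
  refine rl_glue (Fin.castAddEmb n) (Fin.natAddEmb m) ?_ ?_ ?_ ?_ ?_
  · intro a b _ _ h
    have := congrArg Fin.val h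
    simp at this
    omega
  · intro c
    rcases lt_or_ge (c : ℕ) m with h | h
    · exact Or.inl ⟨⟨c, h⟩, rfl⟩
    · exact Or.inr ⟨⟨c - m, by omega⟩, Fin.ext (by simp; omega)⟩
  · intro a _
    ext
    simp [dsum_of_lt]
  · intro a b h
    have := congrArg Fin.val h
    have := hf.1 a a.2
    simp at *
    omega
  · intro b _
    ext
    simp [dsum_add]

theorem dft_dsum {m n : ℕ} {f g : ℕ → ℕ} (hf : IsPerm m f) (hg : IsPerm n g) :
    dft (m + n) (dsum m f g) = dft m f + dft n g := by
  unfold dft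
  rw [disp_dsum, inv_dsum hf, rlFun_dsum hf hg]
  ring

theorem inv_top {m : ℕ} {f : ℕ → ℕ} (hf : IsPerm m f) : inv (m + 1) (top m f) = m + inv m f := by
  rw [inv_succ_left]
  congr 1
  rw [sum_congr rfl fun j hj => if_pos (by simpa using hf.1 j (mem_range.1 hj))]
  simp

theorem disp_top (m : ℕ) (f : ℕ → ℕ) :
    disp (m + 1) (top m f) = m + ∑ i ∈ range m, |(f i : ℤ) - (i + 1)| := by
  unfold disp
  rw [sum_range_succ', add_comm]
  congr 1
  simp

/-- The first factor acts on `{0, …, m}` and the second on `{m, …, m + n}`, so they meet only in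
`m`. Their product sends `0` to `m` and on to `m + n`, which is the leading entry required. -/
theorem rlFun_top_dsum {m n : ℕ} {f g : ℕ → ℕ} (hf : IsPerm m f) (hg : IsPerm n g) :
    rlFun (m + n + 1) (top (m + n) (dsum m f g)) =
      rlFun (m + 1) (top m f) + rlFun (n + 1) (top n g) := by
  rw [rlFun_eq (hf.dsum hg).top, rlFun_eq hf.top, rlFun_eq hg.top]
  let φ : Fin (m + 1) ↪ Fin (m + n + 1) := Fin.castLEEmb (by omega)
  let ψ : Fin (n + 1) ↪ Fin (m + n + 1) := Fin.natAddEmb m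
  have hφ : ∀ a, (φ a : ℕ) = a := fun a => rfl
  have hψ : ∀ b, (ψ b : ℕ) = m + b := fun b => rfl
  refine rl_glue φ ψ ?_ ?_ ?_ ?_ ?_
  · intro a b a' b' h h'
    have h := congrArg Fin.val h
    have h' := congrArg Fin.val h'
    rw [hφ, hψ] at h h'
    ext
    rw [hφ, hφ]
    omega
  · intro c
    rcases lt_or_ge (c : ℕ) m with h | h
    · exact Or.inl ⟨⟨c, by omega⟩, rfl⟩
    · exact Or.inr ⟨⟨c - m, by omega⟩, Fin.ext (by rw [hψ]; simp; omega)⟩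
  · rintro ⟨_ | a, ha⟩ h
    · exfalso
      apply h 0
      ext
      rw [hψ, hφ]
      simp
    · ext
      simp [hφ, dsum_of_lt _ _ (show a < m by omega)]
  · rintro ⟨_ | a, ha⟩ b h
    · have h := congrArg Fin.val h
      rw [hψ, hφ] at h
      have hb : (b : ℕ) = 0 := by simp at h; exact congrArg Fin.val h
      ext
      simp [hφ, hψ, hb]
    · have h := congrArg Fin.val h
      have := hf.1 a (by omega)
      rw [hψ, hφ] at h
      simp at h
      omega
  · rintro ⟨_ | b, hb⟩ h
    · exfalso
      apply h ⟨m, by omega⟩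
      ext
      rw [hψ, hφ]
      simp
    · ext
      have : (ψ ⟨b + 1, hb⟩ : ℕ) = (m + b) + 1 := rfl
      rw [IsPerm.toPerm_val, this, hψ, IsPerm.toPerm_val]
      simp [dsum_add]

theorem dft_top_dsum {m n : ℕ} {f g : ℕ → ℕ} (hf : IsPerm m f) (hg : IsPerm n g) :
    dft (m + n + 1) (top (m + n) (dsum m f g)) =
      dft (m + 1) (top m f) + dft (n + 1) (top n g) := by
  unfold dft
  have h : ∑ i ∈ range (m + n), |(dsum m f g i : ℤ) - (i + 1)| =
      ∑ i ∈ range m, |(f i : ℤ) - (i + 1)| + ∑ i ∈ range n, |(g i : ℤ) - (i + 1)| := by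
    rw [sum_range_add]
    congr 1
    · exact sum_congr rfl fun i hi => by rw [dsum_of_lt _ _ (mem_range.1 hi)]
    · refine sum_congr rfl fun i _ => ?_
      rw [dsum_add]
      push_cast
      congr 1
      ring
  rw [rlFun_top_dsum hf hg, disp_top, disp_top, disp_top, inv_top (hf.dsum hg), inv_top hf,
    inv_top hg, inv_dsum hf, h]
  push_cast
  ring

theorem dft_zero (f : ℕ → ℕ) : dft 0 f = 0 := by
  have h : IsPerm 0 f := ⟨by simp, by simp⟩
  have : h.toPerm = 1 := Subsingleton.elim _ _
  unfold dft
  rw [rlFun_eq h, this, rl_one]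
  simp [disp, inv]

theorem dft_one (f : ℕ → ℕ) (hf : f 0 = 0) : dft 1 f = 0 := by
  have h : IsPerm 1 f := ⟨by simp [hf], by simp⟩
  have : h.toPerm = 1 := Subsingleton.elim _ _
  unfold dft
  rw [rlFun_eq h, this, rl_one]
  simp [disp, inv, hf]

/-- The Diaconis–Graham inequality. -/
theorem dft_nonneg : ∀ (n : ℕ) (f : ℕ → ℕ), IsPerm n f → 0 ≤ dft n f := by
  intro n
  induction n with
  | zero => intro f _; rw [dft_zero]
  | succ n ih =>
    intro f hf
    by_cases h0 : f 0 = 0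
    · have hpos : ∀ i < n, f (i + 1) ≠ 0 := fun i hi h => by
        have := hf.2 (i + 1) (by omega) 0 (by omega) (by rw [h, h0])
        omega
      have he : IsPerm n fun i => f (i + 1) - 1 := by
        constructor
        · intro i hi
          have h1 := hf.1 (i + 1) (by omega)
          have h2 := hpos i hi
          dsimp only
          omega
        · intro i hi j hj h
          have h1 := hpos i hi
          have h2 := hpos j hj
          have := hf.2 (i + 1) (by omega) (j + 1) (by omega) (by dsimp only at h; omega)
          omega
      have h1 : IsPerm 1 fun _ => 0 := ⟨by simp, by simp⟩
      have heq : dft (n + 1) f = dft (1 + n) (dsum 1 (fun _ => 0) fun i => f (i + 1) - 1) := by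
        rw [add_comm]
        refine dft_congr fun i hi => ?_
        rcases i with _ | i
        · simp [dsum, h0]
        · have := hpos i (by omega)
          simp [dsum]
          omega
      rw [heq, dft_dsum h1 he, dft_one _ rfl, zero_add]
      exact ih _ he
    · obtain ⟨q, hq, hq0⟩ := hf.exists_eq (v := 0) (by omega)
      obtain ⟨q, rfl⟩ : ∃ q', q = q' + 1 := ⟨q - 1, by
        rcases q with _ | q
        · exact absurd hq0 h0
        · rfl⟩
      have hpos : ∀ i < n, i ≠ q → f (i + 1) ≠ 0 := fun i hi hiq h => by
        have := hf.2 (i + 1) (by omega) (q + 1) (by omega) (by rw [h, hq0])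
        omega
      -- Deleting `0` from its cycle: the preimage of `0` now takes the value `f 0`, and everything
      -- is shifted down by one.
      set e : ℕ → ℕ := fun i => if i = q then f 0 - 1 else f (i + 1) - 1 with he
      have heq : e q = f 0 - 1 := by simp [he]
      have hei : ∀ i, i ≠ q → e i = f (i + 1) - 1 := fun i hi => by simp [he, hi]
      have hep : IsPerm n e := by
        constructor
        · intro i hi
          by_cases hiq : i = q
          · have := hf.1 0 (by omega)
            rw [hiq, heq]
            omega
          · have := hf.1 (i + 1) (by omega)
            have := hpos i hi hiq
            rw [hei i hiq]
            omega
        · intro i hi j hj h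
          by_cases hiq : i = q <;> by_cases hjq : j = q
          · omega
          · rw [hiq, heq, hei j hjq] at h
            have := hpos j hj hjq
            have := hf.2 0 (by omega) (j + 1) (by omega) (by omega)
            omega
          · rw [hjq, heq, hei i hiq] at h
            have := hpos i hi hiq
            have := hf.2 0 (by omega) (i + 1) (by omega) (by omega)
            omega
          · rw [hei i hiq, hei j hjq] at h
            have := hpos i hi hiq
            have := hpos j hj hjq
            have := hf.2 (i + 1) (by omega) (j + 1) (by omega) (by omega)
            omega
      have hqn : q < n := by omega
      rw [dft_remove_zero hqn hf hep (by omega) hq0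
        fun i hi hiq => by rw [hei i hiq]; have := hpos i hi hiq; omega]
      have h1 := ih e hep
      -- The entries before `q` and below `e q` number at most `q` and at most `e q`, so the cost of
      -- the deletion is nonnegative.
      have h2 : ∑ i ∈ range n, (if i < q ∧ e i < e q then (1 : ℤ) else 0) ≤ q := by
        rw [← sum_ite_lt n q hqn.le]
        refine sum_le_sum fun i _ => ?_
        split_ifs <;> omega
      have h3 : ∑ i ∈ range n, (if i < q ∧ e i < e q then (1 : ℤ) else 0) ≤ e q := by
        rw [← hep.sum_lt (hep.1 q hqn).le]
        refine sum_le_sum fun i _ => ?_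
        split_ifs <;> omega
      have h4 : ((min q (e q) : ℕ) : ℤ) = min (q : ℤ) (e q) := by push_cast; rfl
      have h5 := le_min h2 h3
      linarith

end ShallowPerm

/-! ### Deleting both extremes, and when this costs nothing -/

namespace ShallowPerm

open Finset

/-- The sum counts positions that are both after `q` and above `e q`; there are `n - 1 - q` of the
first kind and `n - 1 - e q` of the second. -/
theorem IsPerm.remove_last_cost_nonneg {n q : ℕ} (hq : q < n) {e : ℕ → ℕ} (he : IsPerm n e) :
    0 ≤ (n : ℤ) - 1 - (max q (e q) : ℕ) -
      ∑ i ∈ range n, if q < i ∧ e q < e i then (1 : ℤ) else 0 := by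
  have h2 : ∑ i ∈ range n, (if q < i ∧ e q < e i then (1 : ℤ) else 0) ≤ n - 1 - q := by
    rw [← sum_ite_gt n q hq]
    refine sum_le_sum fun i _ => ?_
    split_ifs <;> omega
  have h3 : ∑ i ∈ range n, (if q < i ∧ e q < e i then (1 : ℤ) else 0) ≤ n - 1 - e q := by
    rw [← he.sum_gt (he.1 q hq)]
    refine sum_le_sum fun i _ => ?_
    split_ifs <;> omega
  rcases le_total q (e q) with h | h
  · rw [max_eq_right h]; linarith
  · rw [max_eq_left h]; linarith

theorem IsPerm.remove_last_cost_eq_zero {n q : ℕ} (hq : q < n) {e : ℕ → ℕ} (he : IsPerm n e)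
    (h : ∀ i < n, q < i → e q < e i) :
    (n : ℤ) - 1 - (max q (e q) : ℕ) -
      ∑ i ∈ range n, (if q < i ∧ e q < e i then (1 : ℤ) else 0) = 0 := by
  have h0 := he.remove_last_cost_nonneg hq
  have h1 : ∑ i ∈ range n, (if q < i ∧ e q < e i then (1 : ℤ) else 0) = n - 1 - q := by
    rw [← sum_ite_gt n q hq]
    refine sum_congr rfl fun i hi => ?_
    have := h i (mem_range.1 hi)
    split_ifs <;> first | rfl | omega
  rw [h1] at h0 ⊢
  have : q ≤ max q (e q) := le_max_left _ _
  have : (q : ℤ) ≤ (max q (e q) : ℕ) := by exact_mod_cast this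
  linarith

/-- Zero cost means that the later positions all have larger values, or that the larger values all
come later. The entry at `r` is larger and earlier, which excludes the second alternative. -/
theorem IsPerm.lt_of_remove_last_cost_eq_zero {n q r : ℕ} (hq : q < n) {e : ℕ → ℕ}
    (he : IsPerm n e) (hr : r < q) (her : e q < e r)
    (h : (n : ℤ) - 1 - (max q (e q) : ℕ) -
      ∑ i ∈ range n, (if q < i ∧ e q < e i then (1 : ℤ) else 0) = 0) :
    ∀ i < n, q < i → e q < e i := by
  have key : ∀ F : ℕ → ℤ, (∀ i ∈ range n, (if q < i ∧ e q < e i then (1 : ℤ) else 0) ≤ F i) →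
      ∑ i ∈ range n, F i ≤ ∑ i ∈ range n, (if q < i ∧ e q < e i then (1 : ℤ) else 0) →
      ∀ i ∈ range n, (if q < i ∧ e q < e i then (1 : ℤ) else 0) = F i := fun F hF hs =>
    (sum_eq_sum_iff_of_le hF).1 (le_antisymm (sum_le_sum hF) hs)
  rcases le_total q (e q) with hle | hle
  · exfalso
    rw [max_eq_right hle] at h
    have := key (fun i => if e q < e i then 1 else 0)
      (fun i _ => by split_ifs <;> omega) (by rw [he.sum_gt (he.1 q hq)]; linarith)
      r (mem_range.2 (by omega))
    simp [her, hr.not_gt] at this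
  · intro i hi hqi
    rw [max_eq_left hle] at h
    have := key (fun i => if q < i then 1 else 0)
      (fun i _ => by split_ifs <;> omega) (by rw [sum_ite_gt n q hq]; linarith)
      i (mem_range.2 hi)
    by_contra hcon
    simp [hqi, hcon] at this

/-- Removing `0` and the maximum from their cycles, when the maximum comes first. -/
theorem dft_remove_both {n q : ℕ} (hq : q < n) {f e : ℕ → ℕ} (hf : IsPerm (n + 2) f)
    (he : IsPerm n e) (h0 : f 0 = n + 1) (h1 : f (q + 1) = 0) (hl : f (n + 1) = e q + 1)
    (h2 : ∀ i < n, i ≠ q → f (i + 1) = e i + 1) :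
    dft (n + 2) f = dft n e + 2 * (n - 1 - (max q (e q) : ℕ) -
      ∑ i ∈ range n, if q < i ∧ e q < e i then (1 : ℤ) else 0) := by
  -- The intermediate permutation, with `0` deleted and the maximum still present. As the maximum
  -- sits at `q`, all earlier entries are smaller and the first deletion is free.
  set g : ℕ → ℕ := fun i => if i = q then n else if i = n then e q else e i with hg
  have hgq : g q = n := by simp [hg]
  have hgn : g n = e q := by simp [hg, hq.ne']
  have hgi : ∀ i < n, i ≠ q → g i = e i := fun i hi hiq => by simp [hg, hi.ne, hiq]
  have hgp : IsPerm (n + 1) g := by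
    constructor
    · intro i hi
      by_cases hiq : i = q
      · rw [hiq, hgq]; omega
      by_cases hin : i = n
      · have := he.1 q hq
        rw [hin, hgn]; omega
      · have := he.1 i (by omega)
        rw [hgi i (by omega) hiq]; omega
    · have hlt : ∀ i < n + 1, i ≠ q → g i < n := fun i hi hiq => by
        by_cases hin : i = n
        · rw [hin, hgn]; exact he.1 q hq
        · rw [hgi i (by omega) hiq]; exact he.1 i (by omega)
      have hne : ∀ i < n, i ≠ q → g i ≠ g n := fun i hi hiq h => by
        rw [hgi i hi hiq, hgn] at h
        exact hiq (he.2 i hi q hq h)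
      intro i hi j hj hij
      by_cases hiq : i = q <;> by_cases hjq : j = q
      · omega
      · have := hlt j hj hjq
        rw [← hij, hiq, hgq] at this
        omega
      · have := hlt i hi hiq
        rw [hij, hjq, hgq] at this
        omega
      by_cases hin : i = n <;> by_cases hjn : j = n
      · omega
      · exact absurd (hin ▸ hij).symm (hne j (by omega) hjq)
      · exact absurd (hjn ▸ hij) (hne i (by omega) hiq)
      · rw [hgi i (by omega) hiq, hgi j (by omega) hjq] at hij
        exact he.2 i (by omega) j (by omega) hij
  rw [dft_remove_zero (n := n + 1) (q := q) (by omega) hf hgp (by rw [h0, hgq]) h1,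
    dft_remove_last hq hgp he hgn hgq hgi]
  · have : ∑ i ∈ range (n + 1), (if i < q ∧ g i < g q then (1 : ℤ) else 0) = q := by
      rw [← sum_ite_lt (n + 1) q (by omega)]
      refine sum_congr rfl fun i _ => ?_
      by_cases hiq : i < q
      · have := he.1 i (by omega)
        simp [hiq, hgq, hgi i (by omega) hiq.ne, this]
      · simp [hiq]
    rw [this, hgq, min_eq_left hq.le]
    ring
  · intro i hi hiq
    by_cases hin : i = n
    · rw [hin, hl, hgn]
    · rw [h2 i (by omega) hiq, hgi i (by omega) hiq]

theorem dft_remove_both_eq {n q : ℕ} (hq : q < n) {f e : ℕ → ℕ} (hf : IsPerm (n + 2) f)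
    (he : IsPerm n e) (h0 : f 0 = n + 1) (h1 : f (q + 1) = 0) (hl : f (n + 1) = e q + 1)
    (h2 : ∀ i < n, i ≠ q → f (i + 1) = e i + 1) (h3 : ∀ i < n, q < i → e q < e i) :
    dft (n + 2) f = dft n e := by
  rw [dft_remove_both hq hf he h0 h1 hl h2, he.remove_last_cost_eq_zero hq h3]
  simp

/-- Here `0` and the maximum form a two-cycle. Deleting `0` leaves the maximum as a fixed point at
the end, a direct summand of defect zero. -/
theorem dft_remove_ends {n : ℕ} {f e : ℕ → ℕ} (hf : IsPerm (n + 2) f)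
    (he : IsPerm n e) (h0 : f 0 = n + 1) (hl : f (n + 1) = 0)
    (h2 : ∀ i < n, f (i + 1) = e i + 1) : dft (n + 2) f = dft n e := by
  have h1 : IsPerm 1 fun _ => 0 := ⟨by simp, by simp⟩
  have hg := he.dsum h1
  have hgn : dsum n e (fun _ => 0) n = n := by simp [dsum]
  rw [dft_remove_zero (n := n + 1) (q := n) (by omega) hf hg (by rw [h0, hgn]) hl,
    dft_dsum he h1, dft_one _ rfl, hgn, min_self]
  · have : ∑ i ∈ range (n + 1), (if i < n ∧ dsum n e (fun _ => 0) i < n then (1 : ℤ) else 0)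
        = n := by
      rw [← sum_ite_lt (n + 1) n (by omega)]
      refine sum_congr rfl fun i _ => ?_
      by_cases hi : i < n
      · have := he.1 i hi
        simp [hi, dsum_of_lt, this]
      · simp [hi]
    rw [this]
    ring
  · intro i hi hin
    rw [dsum_of_lt _ _ (by omega), h2 i (by omega)]

/-- A shallow permutation of the form `n, n - 1, d` is such that the entries of `d` strictly
between its `0` and its end exceed its last entry. -/
theorem lt_of_dft_top_top_eq_zero {m : ℕ} {d : ℕ → ℕ} (hd : IsPerm m d)
    (h : dft (m + 2) (top (m + 1) (top m d)) = 0) {p j : ℕ} (hpj : p < j) (hj : j + 1 < m)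
    (hp : d p = 0) : d (m - 1) < d j := by
  obtain ⟨k, rfl⟩ : ∃ k, m = k + 1 := ⟨m - 1, by omega⟩
  simp only [Nat.add_sub_cancel]
  set a := d k with ha
  have hinj : ∀ i < k + 1, i ≠ p → d i ≠ 0 := fun i hi hip h0 =>
    hip (hd.2 i hi p (by omega) (by rw [h0, hp]))
  have ha0 : a ≠ 0 := hinj k (by omega) (by omega)
  -- The outcome of both deletions: the last entry `a` of `d` moves to the place of `0`, and the
  -- second leading entry becomes the first.
  set e : ℕ → ℕ := fun i => if i = p + 1 then a - 1 else if i = 0 then k else d (i - 1) - 1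
    with he
  have heq : e (p + 1) = a - 1 := by simp [he]
  have he0 : e 0 = k := by simp [he]
  have hei : ∀ i, i ≠ p → e (i + 1) = d i - 1 := fun i hi => by simp [he, hi]
  have hak := hd.1 k (by omega)
  have hep : IsPerm (k + 1) e := by
    have hlt : ∀ i < k, e (i + 1) < k := by
      intro i hi
      by_cases hip : i = p
      · rw [hip, heq]
        omega
      · have := hd.1 i (by omega)
        have := hinj i (by omega) hip
        rw [hei i hip]
        omega
    constructor
    · rintro (_ | i) hi
      · omega
      · have := hlt i (by omega)
        omega
    · rintro (_ | i) hi (_ | j') hj' hij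
      · rfl
      · have := hlt j' (by omega)
        omega
      · have := hlt i (by omega)
        omega
      · by_cases hip : i = p <;> by_cases hjp : j' = p
        · omega
        · rw [hip, heq, hei j' hjp] at hij
          have := hinj j' (by omega) hjp
          have := hd.2 k (by omega) j' (by omega) (by omega)
          omega
        · rw [hjp, heq, hei i hip] at hij
          have := hinj i (by omega) hip
          have := hd.2 k (by omega) i (by omega) (by omega)
          omega
        · rw [hei i hip, hei j' hjp] at hij
          have := hinj i (by omega) hip
          have := hinj j' (by omega) hjp
          have := hd.2 i (by omega) j' (by omega) (by omega)
          omega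
  have hq : p + 1 < k + 1 := by omega
  rw [dft_remove_both hq hd.top.top hep (by simp) (by simp [hp])
    (by rw [heq, top_succ, top_succ]; omega)] at h
  · have h1 := hep.remove_last_cost_nonneg hq
    have h2 := dft_nonneg _ _ hep
    -- The remaining leading entry `e 0 = k` is the earlier, larger entry that is needed.
    have h3 := hep.lt_of_remove_last_cost_eq_zero (r := 0) hq (by omega)
      (by rw [he0, heq]; omega) (by linarith) (j + 1) (by omega) (by omega)
    rw [heq, hei j (by omega)] at h3
    omega
  · rintro (_ | i) hi hiq
    · rw [he0]
      simp
    · have := hinj i (by omega) (by omega)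
      rw [hei i (by omega), top_succ, top_succ]
      omega

end ShallowPerm

/-! ### Plane forests, and the branches possible in a shallow tree -/

namespace ShallowPerm

/-- Plane forests, as lists of plane trees: `cons c t` has first tree a root above the forest `c`,
and further trees `t`. -/
inductive Forest
  | nil : Forest
  | cons (c t : Forest) : Forest

namespace Forest

/-- The number of nodes. -/
def size : Forest → ℕ
  | nil => 0
  | cons c t => c.size + 1 + t.size

/-- The one-line notation of the 231-avoiding permutation encoded by a forest. -/
def val : Forest → ℕ → ℕ
  | nil => fun i => i
  | cons c t => dsum (c.size + 1) (top c.size c.val) t.val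

/-- Concatenation of forests. -/
def append : Forest → Forest → Forest
  | nil, b => b
  | cons c t, b => cons c (t.append b)

/-- The mirror image of a forest. -/
def mirror : Forest → Forest
  | nil => nil
  | cons c t => t.mirror.append (cons c.mirror nil)

/-- A chain of `i` nodes with a forest below. -/
def stem : ℕ → Forest → Forest
  | 0, F => F
  | i + 1, F => cons (stem i F) nil

/-- The path with `m` nodes. -/
abbrev chain (m : ℕ) : Forest := stem m nil

/-- A stem of `i` nodes that carries a path of `k + 1` nodes and a path of `j + 1` nodes. -/
abbrev fork (i k j : ℕ) : Forest := stem i (cons (chain k) (cons (chain j) nil))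

@[simp] theorem size_nil : nil.size = 0 := rfl

@[simp] theorem size_cons (c t : Forest) : (cons c t).size = c.size + 1 + t.size := rfl

@[simp] theorem size_append (a b : Forest) : (a.append b).size = a.size + b.size := by
  induction a with
  | nil => simp [append]
  | cons c t _ ih => simp [append, ih]; omega

@[simp] theorem size_mirror (a : Forest) : a.mirror.size = a.size := by
  induction a with
  | nil => rfl
  | cons c t hc ht => simp [mirror, hc, ht]; omega

@[simp] theorem size_stem (i : ℕ) (F : Forest) : (stem i F).size = i + F.size := by
  induction i with
  | zero => simp [stem]
  | succ i ih => simp [stem, ih]; omega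

theorem stem_chain (i j : ℕ) : stem i (chain j) = chain (i + j) := by
  induction i with
  | zero => simp [stem]
  | succ i ih => rw [stem, ih, Nat.succ_add]; rfl

theorem isPerm (F : Forest) : IsPerm F.size F.val := by
  induction F with
  | nil => exact ⟨by simp, by simp⟩
  | cons c t hc ht => exact hc.top.dsum ht

theorem val_cons_zero (c t : Forest) : (cons c t).val 0 = c.size := by
  simp [val, dsum_of_lt]

theorem val_cons_succ (c t : Forest) {i : ℕ} (hi : i < c.size) :
    (cons c t).val (i + 1) = c.val i := by
  simp [val, dsum_of_lt, hi]

theorem val_cons_add (c t : Forest) (i : ℕ) :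
    (cons c t).val (c.size + 1 + i) = c.size + 1 + t.val i := by
  simp [val, dsum_add]

theorem val_append (a b : Forest) (i : ℕ) :
    (a.append b).val i = dsum a.size a.val b.val i := by
  induction a generalizing i with
  | nil => simp [append, dsum]
  | cons c t _ ih =>
    simp only [append, val, size_cons]
    by_cases h1 : i < c.size + 1
    · rw [dsum_of_lt _ _ h1, dsum_of_lt _ _ (by omega), dsum_of_lt _ _ h1]
    · obtain ⟨j, rfl⟩ := Nat.exists_eq_add_of_le (not_lt.1 h1)
      rw [dsum_add, ih]
      by_cases h2 : j < t.size
      · rw [dsum_of_lt _ _ h2, dsum_of_lt _ _ (by omega), dsum_add]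
      · obtain ⟨k, rfl⟩ := Nat.exists_eq_add_of_le (not_lt.1 h2)
        rw [dsum_add, show c.size + 1 + (t.size + k) = c.size + 1 + t.size + k by omega, dsum_add]
        omega

theorem val_stem {i p : ℕ} (F : Forest) (hp : p < i + F.size) :
    (stem i F).val p = if p < i then F.size + i - 1 - p else F.val (p - i) := by
  induction i generalizing p with
  | zero => simp [stem]
  | succ i ih =>
    rcases p with _ | p
    · simp [stem, val_cons_zero]
      omega
    · rw [stem, val_cons_succ _ _ (by rw [size_stem]; omega), ih (by omega)]
      split_ifs <;> first | omega | (congr 1; omega)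

theorem val_chain {m p : ℕ} (hp : p < m) : (chain m).val p = m - 1 - p := by
  rw [val_stem _ (by simpa using hp), if_pos hp]
  simp

/-- The failure of shallowness of the permutation encoded by a forest. -/
noncomputable def defect (F : Forest) : ℤ := dft F.size F.val

theorem defect_nonneg (F : Forest) : 0 ≤ F.defect := dft_nonneg _ _ F.isPerm

theorem defect_single (c : Forest) : (cons c nil).defect = dft (c.size + 1) (top c.size c.val) := by
  refine dft_congr fun i hi => ?_
  exact dsum_of_lt _ _ hi

theorem defect_cons (c t : Forest) : (cons c t).defect = (cons c nil).defect + t.defect := by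
  rw [defect_single]
  exact dft_dsum c.isPerm.top t.isPerm

theorem defect_append_child (a b : Forest) :
    (cons (a.append b) nil).defect = (cons a nil).defect + (cons b nil).defect := by
  rw [defect_single, defect_single, defect_single, ← dft_top_dsum a.isPerm b.isPerm, size_append]
  refine dft_congr fun i hi => ?_
  unfold top
  split_ifs
  · rfl
  · exact val_append _ _ _

theorem defect_cons_child (d t : Forest) :
    (cons (cons d t) nil).defect = (cons (cons d nil) nil).defect + (cons t nil).defect :=
  defect_append_child (cons d nil) t

/-- A path encodes the decreasing permutation; deleting both extremes shortens it by two. -/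
theorem defect_chain (m : ℕ) : (chain m).defect = 0 := by
  induction m using Nat.strong_induction_on with
  | _ m ih =>
    match m with
    | 0 => exact dft_zero _
    | 1 => exact dft_one _ rfl
    | n + 2 =>
      rw [← ih n (by omega)]
      have hs : ∀ k, (chain k).size = k := fun k => by simp
      have h1 := (chain (n + 2)).isPerm
      have h2 := (chain n).isPerm
      rw [hs] at h1 h2
      unfold defect
      rw [hs, hs]
      refine dft_remove_ends h1 h2 ?_ ?_ fun i hi => ?_
      · rw [val_chain (by omega)]; omega
      · rw [val_chain (by omega)]; omega
      · rw [val_chain (by omega), val_chain (by omega)]; omega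

/-- A path of `k` nodes, a single node and a path of `j` nodes. -/
def triple (k j : ℕ) : Forest := (chain k).append (cons nil (chain j))

@[simp] theorem size_triple (k j : ℕ) : (triple k j).size = k + 1 + j := by
  simp [triple]; omega

theorem val_triple {k j p : ℕ} (hp : p < k + 1 + j) : (triple k j).val p =
    if p < k then k - 1 - p else if p = k then k else 2 * k + 1 + j - p := by
  have hs : (chain k).size = k := by simp
  rw [triple, val_append, hs]
  split_ifs with h1 h2
  · rw [dsum_of_lt _ _ h1, val_chain h1]
  · subst h2
    have := dsum_add p 0 (chain p).val (cons nil (chain j)).val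
    rw [add_zero] at this
    rw [this, val_cons_zero]
    rfl
  · obtain ⟨r, rfl⟩ : ∃ r, p = k + (0 + 1 + r) := ⟨p - k - 1, by omega⟩
    rw [dsum_add]
    have := val_cons_add nil (chain j) r
    rw [size_nil] at this
    rw [this, val_chain (by omega)]
    omega

theorem val_fork_zero {k j p : ℕ} (hp : p < k + j + 2) :
    (cons (chain k) (cons (chain j) nil)).val p =
      if p ≤ k then k - p else 2 * k + j + 2 - p := by
  have hk : (chain k).size = k := by simp
  have hj : (chain j).size = j := by simp
  split_ifs with h
  · rcases p with _ | p
    · rw [val_cons_zero, hk]; rfl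
    · rw [val_cons_succ _ _ (by omega), val_chain (by omega)]
      omega
  · obtain ⟨r, rfl⟩ := Nat.exists_eq_add_of_le (show k + 1 ≤ p by omega)
    have := val_cons_add (chain k) (cons (chain j) nil) r
    rw [hk] at this
    rw [this]
    rcases r with _ | r
    · rw [val_cons_zero, hj]
      omega
    · rw [val_cons_succ _ _ (by omega), val_chain (by omega)]
      omega

/-- Deleting the maximum shortens the stem. Deleting `0` shortens the first path to `k` nodes. The
last entry, the minimum of the second path, moves to the place of `0` and becomes the isolated
middle node, which leaves `j` nodes in the second path. All entries after it are larger, so nothing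
is lost. -/
theorem defect_fork (i k j : ℕ) : (fork (i + 2) k j).defect = (stem (i + 1) (triple k j)).defect := by
  have hs1 : (fork (i + 2) k j).size = (i + k + j + 2) + 2 := by simp; omega
  have hs2 : (stem (i + 1) (triple k j)).size = i + k + j + 2 := by simp; omega
  have hs3 : (cons (chain k) (cons (chain j) nil)).size = k + j + 2 := by simp; omega
  have h1 := (fork (i + 2) k j).isPerm
  have h2 := (stem (i + 1) (triple k j)).isPerm
  rw [hs1] at h1
  rw [hs2] at h2
  have hf : ∀ p < i + k + j + 4, (fork (i + 2) k j).val p =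
      if p < i + 2 then i + k + j + 3 - p else if p ≤ i + 2 + k then i + 2 + k - p
        else i + 2 * k + j + 4 - p := by
    intro p hp
    rw [val_stem _ (by rw [hs3]; omega), hs3]
    split_ifs with h1 h2
    · omega
    · rw [val_fork_zero (by omega), if_pos (by omega)]; omega
    · rw [val_fork_zero (by omega), if_neg (by omega)]; omega
  have he : ∀ p < i + k + j + 2, (stem (i + 1) (triple k j)).val p =
      if p < i + 1 then i + k + j + 1 - p else if p < i + 1 + k then i + k - p
        else if p = i + 1 + k then k else i + 2 * k + 2 + j - p := by
    intro p hp
    rw [val_stem _ (by rw [size_triple]; omega), size_triple]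
    split_ifs with h1 h2 h3
    · omega
    · rw [val_triple (by omega), if_pos (by omega)]; omega
    · rw [val_triple (by omega), if_neg (by omega), if_pos (by omega)]
    · rw [val_triple (by omega), if_neg (by omega), if_neg (by omega)]; omega
  unfold defect
  rw [hs1, hs2]
  refine dft_remove_both_eq (q := i + 1 + k) (by omega) h1 h2 ?_ ?_ ?_ ?_ ?_
  · rw [hf _ (by omega)]; split_ifs <;> omega
  · rw [hf _ (by omega)]; split_ifs <;> omega
  · rw [hf _ (by omega), he _ (by omega)]; split_ifs <;> omega
  · intro p hp hpq
    rw [hf _ (by omega), he _ (by omega)]; split_ifs <;> omega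
  · intro p hp hpq
    rw [he _ (by omega), he _ (by omega)]; split_ifs <;> omega

theorem lt_of_defect_eq_zero {d : Forest} (h : (cons (cons d nil) nil).defect = 0) {p j : ℕ}
    (hpj : p < j) (hj : j + 1 < d.size) (hp : d.val p = 0) : d.val (d.size - 1) < d.val j := by
  refine lt_of_dft_top_top_eq_zero d.isPerm ?_ hpj hj hp
  rw [defect_single] at h
  rw [← h]
  refine dft_congr fun i hi => ?_
  rcases i with _ | i
  · rfl
  · rw [top_succ, top_succ]
    exact (dsum_of_lt _ _ (by omega)).symm

/-- After `defect_fork`, a stem of one node is a root over separate paths, which is shallow. For a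
longer stem, an empty path in the triple leaves a fork with a shorter stem (or a path), and
induction applies. If both paths are nonempty, the order condition `lt_of_defect_eq_zero` fails. -/
theorem defect_fork_eq_zero_iff (i k j : ℕ) :
    (fork (i + 2) k j).defect = 0 ↔ i = 0 ∨ k = 0 ∨ j = 0 := by
  induction i generalizing k j with
  | zero =>
    simp only [true_or, iff_true]
    rw [defect_fork]
    have h1 : stem (0 + 1) (triple k j) =
        cons ((chain k).append ((chain 1).append (chain j))) nil := rfl
    have h2 (m : ℕ) : (cons (chain m) nil).defect = 0 := defect_chain (m + 1)
    rw [h1, defect_append_child, defect_append_child, h2, h2, h2]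
    rfl
  | succ i ih =>
    rw [defect_fork]
    simp only [Nat.add_eq_zero_iff, one_ne_zero, and_false, false_or]
    rcases k with _ | k
    · simp only [true_or, iff_true]
      rcases j with _ | j
      · have : triple 0 0 = chain 1 := rfl
        rw [this, stem_chain]
        exact defect_chain _
      · have : triple 0 (j + 1) = cons (chain 0) (cons (chain j) nil) := rfl
        rw [this]
        exact (ih 0 j).2 (by simp)
    · rcases j with _ | j
      · simp only [or_true, iff_true]
        have : triple (k + 1) 0 = cons (chain k) (cons (chain 0) nil) := rfl
        rw [this]
        exact (ih k 0).2 (by simp)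
      · simp only [Nat.add_eq_zero_iff, one_ne_zero, and_false, or_self, iff_false]
        intro h
        have hv : ∀ p < i + (k + 1 + 1 + (j + 1)), (stem i (triple (k + 1) (j + 1))).val p =
            if p < i then (k + 1 + 1 + (j + 1)) + i - 1 - p else
              (triple (k + 1) (j + 1)).val (p - i) := fun p hp => by
          rw [val_stem _ (by rw [size_triple]; exact hp), size_triple]
        -- The value `0` ends the first path at position `i + k`. The middle node after it has value
        -- `k + 1`, below the last entry `k + 2`.
        have := lt_of_defect_eq_zero (d := stem i (triple (k + 1) (j + 1))) h (p := i + k)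
          (j := i + k + 1) (by omega) (by simp; omega) (by
            rw [hv _ (by omega), if_neg (by omega), val_triple (by omega), if_pos (by omega)]
            omega)
        rw [size_stem, size_triple, hv _ (by omega), hv _ (by omega), if_neg (by omega),
          if_neg (by omega), val_triple (by omega), val_triple (by omega), if_neg (by omega),
          if_neg (by omega), if_neg (by omega), if_pos (by omega)] at this
        omega

/-- With a second tree, the last entry would exceed the whole first tree. So there is one tree, and
the same holds below its root. -/
theorem exists_chain_of_last_eq_zero (d : Forest) (hd : 0 < d.size)
    (h : d.val (d.size - 1) = 0) : ∃ k, d = chain (k + 1) := by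
  induction d with
  | nil => simp at hd
  | cons c t hc ht =>
    rcases t with _ | ⟨c', t'⟩
    · by_cases h0 : c.size = 0
      · rcases c with _ | _
        · exact ⟨0, rfl⟩
        · simp at h0
      · have h1 := val_cons_succ c nil (i := c.size - 1) (by omega)
        have h2 : (cons c nil).size - 1 = c.size - 1 + 1 := by simp; omega
        rw [h2, h1] at h
        obtain ⟨k, hk⟩ := hc (by omega) h
        exact ⟨k + 1, by rw [hk]; rfl⟩
    · exfalso
      have h1 := val_cons_add c (cons c' t') (c'.size + t'.size)
      have h2 : (cons c (cons c' t')).size - 1 = c.size + 1 + (c'.size + t'.size) := by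
        simp; omega
      rw [h2, h1] at h
      omega

/-- A single tree passes the condition on to its children, which lengthens the stem. If there are
more trees, the last entry exceeds the whole first tree, so no entry of that tree may follow `0`;
the first tree then ends in `0` and is a path. The minimum of the other trees cannot precede the
last entry either, so they form one path. -/
theorem eq_chain_or_fork (d : Forest)
    (h : ∀ p j, p < j → j + 1 < d.size → d.val p = 0 → d.val (d.size - 1) < d.val j) :
    (∃ m, d = chain m) ∨ ∃ i k j, d = fork i k j := by
  induction d with
  | nil => exact Or.inl ⟨0, rfl⟩
  | cons c t hc ht =>
    rcases Nat.eq_zero_or_pos t.size with h0 | hpos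
    · obtain rfl : t = nil := by
        rcases t with _ | _
        · rfl
        · simp at h0
      have hlast : 0 < c.size → (cons c nil).val ((cons c nil).size - 1) = c.val (c.size - 1) := by
        intro hc0
        rw [← val_cons_succ c nil (i := c.size - 1) (by omega)]
        congr 1
        simp
        omega
      have := hc fun p j hpj hj hp => by
        have := h (p + 1) (j + 1) (by omega) (by simp; omega)
          (by rw [val_cons_succ _ _ (by omega), hp])
        rwa [hlast (by omega), val_cons_succ _ _ (by omega)] at this
      rcases this with ⟨m, rfl⟩ | ⟨i, k, j, rfl⟩
      · exact Or.inl ⟨m + 1, rfl⟩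
      · exact Or.inr ⟨i + 1, k, j, rfl⟩
    · right
      have hlast : (cons c t).val ((cons c t).size - 1) = c.size + 1 + t.val (t.size - 1) := by
        rw [← val_cons_add]
        congr 1
        simp
        omega
      obtain ⟨p, hp, hp0⟩ := (cons c nil).isPerm.exists_eq (v := 0) (by simp)
      simp only [size_cons, size_nil] at hp
      have htop : ∀ i < c.size + 1, (cons c t).val i = (cons c nil).val i := fun i hi => by
        simp only [val]
        rw [dsum_of_lt _ _ hi, dsum_of_lt _ _ hi]
      have hp0' : (cons c t).val p = 0 := by rw [htop p (by omega), hp0]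
      have hpc : p = c.size := by
        by_contra hne
        have := h p c.size (by omega) (by simp; omega) hp0'
        have h2 := (cons c nil).isPerm.1 c.size (by simp)
        rw [hlast, htop _ (by omega)] at this
        simp only [size_cons, size_nil] at h2
        omega
      obtain ⟨k, hk⟩ := exists_chain_of_last_eq_zero (cons c nil) (by simp)
        (by simpa [hpc] using hp0)
      have ht0 : t.val (t.size - 1) = 0 := by
        obtain ⟨r, hr, hr0⟩ := t.isPerm.exists_eq hpos
        by_cases hrt : r = t.size - 1
        · rw [← hrt, hr0]
        · have := h p (c.size + 1 + r) (by omega) (by simp; omega) hp0'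
          rw [hlast, val_cons_add, hr0] at this
          omega
      obtain ⟨j, hj⟩ := exists_chain_of_last_eq_zero t hpos ht0
      refine ⟨0, k, j, ?_⟩
      have hck : c = chain k := by
        simp only [chain, stem, cons.injEq, and_true] at hk
        exact hk
      rw [hj, hck]
      rfl

end Forest

end ShallowPerm

/-! ### Mirror images, lists of trees, and limbs -/

namespace ShallowPerm

namespace Forest

theorem mirror_stem (i : ℕ) (F : Forest) : (stem i F).mirror = stem i F.mirror := by
  induction i with
  | zero => rfl
  | succ i ih => simp only [stem, mirror, append, ih]

theorem mirror_fork (i k j : ℕ) : (fork i k j).mirror = fork i j k := by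
  simp only [fork, chain, mirror_stem, mirror, append]

theorem chain_injective {m m' : ℕ} (h : chain m = chain m') : m = m' := by
  simpa using congrArg size h

theorem stem_branch_inj {i i' : ℕ} {A B A' B' : Forest}
    (h : stem i (cons A (cons B nil)) = stem i' (cons A' (cons B' nil))) :
    i = i' ∧ A = A' ∧ B = B' := by
  induction i generalizing i' with
  | zero =>
    rcases i' with _ | i'
    · simpa [stem] using h
    · simp [stem] at h
  | succ i ih =>
    rcases i' with _ | i'
    · simp [stem] at h
    · simp only [stem, cons.injEq, and_true] at h
      obtain ⟨rfl, h'⟩ := ih h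
      exact ⟨rfl, h'⟩

theorem chain_ne_stem_branch (m i : ℕ) (A B : Forest) :
    chain m ≠ stem i (cons A (cons B nil)) := by
  induction i generalizing m with
  | zero => rcases m with _ | m <;> simp [stem]
  | succ i ih =>
    rcases m with _ | m
    · simp [stem]
    · simpa [stem] using ih m

/-- The forest with one tree for each entry of a list, with prescribed children of its root. -/
def build {α : Type*} (g : α → Forest) : List α → Forest
  | [] => nil
  | a :: l => cons (g a) (build g l)

section Build

variable {α : Type*} {g : α → Forest}

theorem build_append (l l' : List α) : build g (l ++ l') = (build g l).append (build g l') := by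
  induction l with
  | nil => rfl
  | cons a l ih => simp [build, append, ih]

theorem build_injective (hg : Function.Injective g) : Function.Injective (build g) := by
  intro l
  induction l with
  | nil => intro l' h; rcases l' with _ | _ <;> simp_all [build]
  | cons a l ih =>
    intro l' h
    rcases l' with _ | ⟨a', l'⟩
    · simp [build] at h
    · simp only [build, cons.injEq] at h
      rw [hg h.1, ih h.2]

theorem mirror_build {m : α → α} (hm : ∀ a, (g a).mirror = g (m a)) (l : List α) :
    (build g l).mirror = build g (l.map m).reverse := by
  induction l with
  | nil => rfl
  | cons a l ih => simp [build, mirror, ih, hm, build_append]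

theorem size_build (l : List α) : (build g l).size = (l.map fun a => (g a).size + 1).sum := by
  induction l with
  | nil => rfl
  | cons a l ih => simp [build, ih]

end Build

end Forest

/-- The branches at the root of a shallow tree. -/
inductive Limb
  | path (m : ℕ) : Limb
  | fork (i k j : ℕ) (h : i = 0 ∨ k = 0 ∨ j = 0) : Limb

namespace Limb

/-- The forest below the first node of a limb. -/
def forest : Limb → Forest
  | path m => Forest.chain m
  | fork i k j _ => Forest.fork i k j

/-- The mirror image of a limb. -/
def mirror : Limb → Limb
  | path m => path m
  | fork i k j h => fork i j k (by tauto)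

/-- The number of nodes of a limb. -/
def size : Limb → ℕ
  | path m => m + 1
  | fork i k j _ => i + k + j + 3

theorem size_forest (l : Limb) : l.forest.size + 1 = l.size := by
  cases l <;> simp [forest, size]; omega

theorem mirror_forest (l : Limb) : l.forest.mirror = l.mirror.forest := by
  cases l
  · exact Forest.mirror_stem _ _
  · exact Forest.mirror_fork _ _ _

theorem forest_injective : Function.Injective forest := by
  rintro (m | ⟨i, k, j, h⟩) (m' | ⟨i', k', j', h'⟩) hl
  · rw [Forest.chain_injective hl]
  · exact absurd hl (Forest.chain_ne_stem_branch _ _ _ _)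
  · exact absurd hl.symm (Forest.chain_ne_stem_branch _ _ _ _)
  · obtain ⟨rfl, hk, hj⟩ := Forest.stem_branch_inj hl
    obtain rfl := Forest.chain_injective hk
    obtain rfl := Forest.chain_injective hj
    rfl

end Limb

/-! ### Shallow forests as lists of lists of limbs; forests as 231-avoiding permutations -/

namespace Forest

theorem defect_limb_eq_zero_iff (d : Forest) :
    (cons (cons d nil) nil).defect = 0 ↔ ∃ l : Limb, l.forest = d := by
  constructor
  · intro h
    rcases eq_chain_or_fork d fun p j hpj hj hp => lt_of_defect_eq_zero h hpj hj hp with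
      ⟨m, rfl⟩ | ⟨i, k, j, rfl⟩
    · exact ⟨Limb.path m, rfl⟩
    · exact ⟨Limb.fork i k j ((defect_fork_eq_zero_iff i k j).1 h), rfl⟩
  · rintro ⟨m | ⟨i, k, j, h⟩, rfl⟩
    · exact defect_chain (m + 2)
    · exact (defect_fork_eq_zero_iff i k j).2 h

/-- The defect is a sum of nonnegative contributions of the children, and a child contributes zero
exactly when it is a limb. -/
theorem defect_tree_eq_zero_iff (c : Forest) :
    (cons c nil).defect = 0 ↔ ∃ l : List Limb, build Limb.forest l = c := by
  induction c with
  | nil => exact ⟨fun _ => ⟨[], rfl⟩, fun _ => defect_chain 1⟩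
  | cons d t _ ih =>
    have h1 := defect_nonneg (cons (cons d nil) nil)
    have h2 := defect_nonneg (cons t nil)
    rw [defect_cons_child, add_eq_zero_iff_of_nonneg h1 h2, defect_limb_eq_zero_iff, ih]
    constructor
    · rintro ⟨⟨l, rfl⟩, ⟨ls, rfl⟩⟩
      exact ⟨l :: ls, rfl⟩
    · rintro ⟨_ | ⟨l, ls⟩, h⟩
      · simp [build] at h
      · simp only [build, cons.injEq] at h
        exact ⟨⟨l, h.1⟩, ⟨ls, h.2⟩⟩

/-- The forests that encode shallow permutations. -/
theorem defect_eq_zero_iff (F : Forest) :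
    F.defect = 0 ↔ ∃ x : List (List Limb), build (build Limb.forest) x = F := by
  induction F with
  | nil => exact ⟨fun _ => ⟨[], rfl⟩, fun _ => defect_chain 0⟩
  | cons c t _ ih =>
    rw [defect_cons, add_eq_zero_iff_of_nonneg (defect_nonneg _) (defect_nonneg _),
      defect_tree_eq_zero_iff, ih]
    constructor
    · rintro ⟨⟨l, rfl⟩, ⟨ls, rfl⟩⟩
      exact ⟨l :: ls, rfl⟩
    · rintro ⟨_ | ⟨l, ls⟩, h⟩
      · simp [build] at h
      · simp only [build, cons.injEq] at h
        exact ⟨⟨l, h.1⟩, ⟨ls, h.2⟩⟩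

theorem val_avoids (F : Forest) {i j k : ℕ} (hij : i < j) (hjk : j < k) (hk : k < F.size) :
    ¬ (F.val k < F.val i ∧ F.val i < F.val j) := by
  induction F generalizing i j k with
  | nil => simp at hk
  | cons c t hc ht =>
    rw [size_cons] at hk
    have hlt : ∀ x < c.size + 1, (cons c t).val x ≤ c.size := by
      rintro (_ | x) hx
      · rw [val_cons_zero]
      · rw [val_cons_succ _ _ (by omega)]
        exact (c.isPerm.1 x (by omega)).le
    by_cases hk' : k < c.size + 1
    · obtain ⟨j, rfl⟩ : ∃ j', j = j' + 1 := ⟨j - 1, by omega⟩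
      obtain ⟨k, rfl⟩ : ∃ k', k = k' + 1 := ⟨k - 1, by omega⟩
      rcases i with _ | i
      · have := hlt (j + 1) (by omega)
        rw [val_cons_zero]
        omega
      · rw [val_cons_succ _ _ (by omega), val_cons_succ _ _ (by omega),
          val_cons_succ _ _ (by omega)]
        exact hc (by omega) (by omega) (by omega)
    · obtain ⟨k, rfl⟩ := Nat.exists_eq_add_of_le (not_lt.1 hk')
      by_cases hi : i < c.size + 1
      · have := hlt i hi
        rw [val_cons_add]
        omega
      · obtain ⟨i, rfl⟩ := Nat.exists_eq_add_of_le (not_lt.1 hi)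
        obtain ⟨j, rfl⟩ := Nat.exists_eq_add_of_le (show c.size + 1 ≤ j by omega)
        have := ht (i := i) (j := j) (k := k) (by omega) (by omega) (by omega)
        rw [val_cons_add, val_cons_add, val_cons_add]
        omega

theorem eq_of_val_eq {F G : Forest} (hs : F.size = G.size)
    (h : ∀ i < F.size, F.val i = G.val i) : F = G := by
  induction F generalizing G with
  | nil =>
    rcases G with _ | _
    · rfl
    · simp at hs
      omega
  | cons c t hc ht =>
    rcases G with _ | ⟨c', t'⟩
    · simp at hs
    · have h0 := h 0 (by simp)
      rw [val_cons_zero, val_cons_zero] at h0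
      simp only [size_cons] at hs h
      have h1 : c = c' := hc h0 fun i hi => by
        have := h (i + 1) (by omega)
        rwa [val_cons_succ _ _ hi, val_cons_succ _ _ (by omega)] at this
      have h2 : t = t' := ht (by omega) fun i hi => by
        have := h (c.size + 1 + i) (by omega)
        rw [val_cons_add, h0, val_cons_add] at this
        omega
      rw [h1, h2]

/-- With the first entry `p` in the role of the 2, avoidance puts all smaller entries before all
larger ones. The smaller ones fill positions `1` to `p` and encode the children of the first root;
the larger ones encode the remaining trees. -/
theorem exists_of_avoids : ∀ (n : ℕ) (f : ℕ → ℕ), IsPerm n f →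
    (∀ i j k, i < j → j < k → k < n → ¬ (f k < f i ∧ f i < f j)) →
    ∃ F : Forest, F.size = n ∧ ∀ i < n, F.val i = f i := by
  intro n
  induction n using Nat.strong_induction_on with
  | _ n ih =>
    intro f hf hav
    rcases n with _ | n
    · exact ⟨nil, rfl, by simp⟩
    set p := f 0 with hp
    have hpn : p < n + 1 := hf.1 0 (by omega)
    have hne : ∀ i, 0 < i → i < n + 1 → f i ≠ p := fun i hi hin h => by
      have := hf.2 i hin 0 (by omega) h
      omega
    have hlow : ∀ i, 0 < i → i ≤ p → f i < p := by
      intro i hi hip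
      by_contra hcon
      have hfi : p < f i := lt_of_le_of_ne (not_lt.1 hcon) (hne i hi (by omega)).symm
      -- Once an entry exceeds `p`, so do all later ones. Since `i ≤ p`, that is more positions than
      -- the `n - p` values above `p`.
      have hall : ∀ j, i ≤ j → j < n + 1 → p < f j := by
        intro j hij hj
        rcases hij.eq_or_lt with rfl | hij
        · exact hfi
        · have := hav 0 i j hi hij hj
          have := hne j (by omega) hj
          omega
      have := Finset.card_le_card_of_injOn (s := Finset.Ico i (n + 1))
        (t := Finset.Ico (p + 1) (n + 1)) f
        (fun j hj => by
          have hj := Finset.mem_Ico.1 hj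
          exact Finset.mem_coe.2 (Finset.mem_Ico.2 ⟨hall j hj.1 hj.2, hf.1 j hj.2⟩))
        (fun a ha b hb hab => hf.2 a (Finset.mem_Ico.1 ha).2 b (Finset.mem_Ico.1 hb).2 hab)
      simp only [Nat.card_Ico] at this
      omega
    have hhigh : ∀ i, p < i → i < n + 1 → p < f i := by
      intro i hpi hi
      by_contra hcon
      have hfi : f i < p := lt_of_le_of_ne (not_lt.1 hcon) (hne i (by omega) hi)
      -- All entries at positions `1` to `i` would be below `p`, but `i > p` positions cannot share
      -- `p` values.
      have hall : ∀ j, 0 < j → j ≤ i → f j < p := by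
        intro j hj hji
        rcases hji.eq_or_lt with rfl | hji
        · exact hfi
        · have := hav 0 j i hj hji hi
          have := hne j hj (by omega)
          omega
      have := Finset.card_le_card_of_injOn (s := Finset.Ico 1 (i + 1))
        (t := Finset.range p) f
        (fun j hj => by
          have hj := Finset.mem_Ico.1 hj
          exact Finset.mem_coe.2 (Finset.mem_range.2 (hall j (by omega) (by omega))))
        (fun a ha b hb hab => hf.2 a (by have := Finset.mem_Ico.1 ha; omega) b
          (by have := Finset.mem_Ico.1 hb; omega) hab)
      simp only [Nat.card_Ico, Finset.card_range] at this
      omega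
    obtain ⟨c, hcs, hc⟩ := ih p hpn (fun i => f (i + 1))
      ⟨fun i hi => hlow _ (by omega) (by omega), fun i hi j hj h => by
        have := hf.2 (i + 1) (by omega) (j + 1) (by omega) h
        omega⟩
      (fun i j k hij hjk hk => hav _ _ _ (by omega) (by omega) (by omega))
    have hsub : ∀ i < n - p, f (p + 1 + i) - (p + 1) + (p + 1) = f (p + 1 + i) := fun i hi => by
      have := hhigh (p + 1 + i) (by omega) (by omega)
      omega
    obtain ⟨t, hts, ht⟩ := ih (n - p) (by omega) (fun i => f (p + 1 + i) - (p + 1))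
      ⟨fun i hi => by
        have := hf.1 (p + 1 + i) (by omega)
        have := hsub i hi
        dsimp only
        omega, fun i hi j hj h => by
        dsimp only at h
        have := hsub i hi
        have := hsub j hj
        have := hf.2 (p + 1 + i) (by omega) (p + 1 + j) (by omega) (by omega)
        omega⟩
      (fun i j k hij hjk hk => by
        have := hav (p + 1 + i) (p + 1 + j) (p + 1 + k) (by omega) (by omega) (by omega)
        have := hsub i (by omega)
        have := hsub j (by omega)
        have := hsub k (by omega)
        omega)
    refine ⟨cons c t, by rw [size_cons]; omega, fun i hi => ?_⟩
    rcases i with _ | i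
    · rw [val_cons_zero, hcs]
    · by_cases hip : i < p
      · rw [val_cons_succ _ _ (by omega), hc i hip]
      · obtain ⟨r, rfl⟩ := Nat.exists_eq_add_of_le (not_lt.1 hip)
        have h1 := val_cons_add c t r
        have h2 := hsub r (by omega)
        rw [hcs, ht r (by omega)] at h1
        rw [show p + r + 1 = p + 1 + r by omega, h1]
        omega

/-- The mirror image encodes the inverse of the reverse-complement. -/
theorem val_mirror (F : Forest) {i : ℕ} (hi : i < F.size) :
    F.mirror.val (F.size - 1 - F.val i) = F.size - 1 - i := by
  induction F generalizing i with
  | nil => simp at hi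
  | cons c t hc ht =>
    simp only [size_cons] at hi
    simp only [mirror, val_append, size_cons]
    rcases i with _ | i
    · rw [val_cons_zero]
      have := dsum_add t.mirror.size 0 t.mirror.val (cons c.mirror nil).val
      rw [val_cons_zero, size_mirror, size_mirror] at this
      rw [size_mirror, show c.size + 1 + t.size - 1 - c.size = t.size + 0 by omega, this]
      omega
    · by_cases hic : i < c.size
      · rw [val_cons_succ _ _ hic]
        have h1 := c.isPerm.1 i hic
        have := dsum_add t.mirror.size (c.size - 1 - c.val i + 1) t.mirror.val
          (cons c.mirror nil).val
        rw [val_cons_succ _ _ (by rw [size_mirror]; omega), hc hic, size_mirror] at this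
        rw [size_mirror, show c.size + 1 + t.size - 1 - c.val i =
          t.size + (c.size - 1 - c.val i + 1) by omega, this]
        omega
      · obtain ⟨r, rfl⟩ := Nat.exists_eq_add_of_le (not_lt.1 hic)
        have h1 := t.isPerm.1 r (by omega)
        rw [show c.size + r + 1 = c.size + 1 + r by omega, val_cons_add,
          show c.size + 1 + t.size - 1 - (c.size + 1 + t.val r) = t.size - 1 - t.val r by omega,
          dsum_of_lt _ _ (by rw [size_mirror]; omega), ht (by omega)]
        omega

/-- By `val_mirror` the right side says that `F` and its mirror image have the same values, as
`F.size - 1 - F.val i` runs through all positions; values determine the forest. -/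
theorem mirror_eq_iff (F : Forest) :
    F.mirror = F ↔ ∀ i < F.size, F.val (F.size - 1 - F.val i) = F.size - 1 - i := by
  constructor
  · intro h i hi
    have := F.val_mirror hi
    rwa [h] at this
  · intro h
    refine eq_of_val_eq (size_mirror F) fun i hi => ?_
    rw [size_mirror] at hi
    obtain ⟨j, hj, hij⟩ := F.isPerm.exists_eq (v := F.size - 1 - i) (by omega)
    have h1 := F.val_mirror hj
    have h2 := h j hj
    rw [hij, show F.size - 1 - (F.size - 1 - i) = i by omega] at h1 h2
    rw [h1, h2]

end Forest

end ShallowPerm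

/-! ### From permutations to palindromic lists of trees -/

namespace ShallowPerm

open Finset

theorem IsPerm.isShallow_iff {n : ℕ} {f : ℕ → ℕ} (h : IsPerm n f) :
    IsShallow h.toPerm ↔ dft n f = 0 := by
  have h1 : totalDisplacement h.toPerm = disp n f := by
    unfold totalDisplacement disp
    rw [Finset.sum_range]
    rfl
  have h2 : (inversionNumber h.toPerm : ℤ) = inv n f := by
    unfold inversionNumber inv
    rw [Finset.sum_range]
    push_cast
    refine Finset.sum_congr rfl fun i _ => ?_
    rw [Finset.sum_range, Finset.card_filter]
    push_cast
    rfl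
  unfold IsShallow dft
  rw [h1, h2, reflectionLength_eq_rl, rlFun_eq h]
  constructor <;> intro <;> linarith

/-- Persymmetry says that `π` times its reverse-complement is the identity. Evaluation at reversed
positions gives the form used in `Forest.mirror_eq_iff`. -/
theorem isPersymmetric_iff {n : ℕ} (π : Equiv.Perm (Fin n)) :
    IsPersymmetric π ↔ ∀ i : Fin n, ((π (Fin.rev (π i)) : Fin n) : ℕ) = n - 1 - i := by
  unfold IsPersymmetric
  rw [eq_inv_iff_mul_eq_one, Equiv.ext_iff]
  have hrev : ∀ i : Fin n, (Fin.rev i : ℕ) = n - 1 - i := fun i => by rw [Fin.val_rev]; omega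
  have hmul : ∀ x : Fin n, (π * reverseComplement π) x = π (Fin.rev (π (Fin.rev x))) := fun x => rfl
  constructor
  · intro h i
    have := h (Fin.rev i)
    rw [hmul, Fin.rev_rev] at this
    rw [this, ← hrev]
    rfl
  · intro h i
    rw [hmul]
    ext
    rw [h, hrev, Equiv.Perm.one_apply]
    omega

/-- The mirror image of a tree, given by the limbs at its root. -/
def treeMirror (l : List Limb) : List Limb := (l.map Limb.mirror).reverse

/-- The number of nodes of a tree, given by the limbs at its root. -/
def treeSize (l : List Limb) : ℕ := (l.map Limb.size).sum + 1

theorem size_build_limbs (l : List Limb) :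
    (Forest.build Limb.forest l).size + 1 = treeSize l := by
  rw [Forest.size_build, treeSize]
  simp only [Limb.size_forest]

theorem size_build_trees (x : List (List Limb)) :
    (Forest.build (Forest.build Limb.forest) x).size = (x.map treeSize).sum := by
  rw [Forest.size_build]
  simp only [size_build_limbs]

theorem mirror_build_trees (x : List (List Limb)) :
    (Forest.build (Forest.build Limb.forest) x).mirror =
      Forest.build (Forest.build Limb.forest) (x.map treeMirror).reverse :=
  Forest.mirror_build (Forest.mirror_build Limb.mirror_forest) x

open Classical in
/-- The permutation of `Fin n` encoded by a forest with `n` nodes. -/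
noncomputable def Forest.perm (n : ℕ) (F : Forest) : Equiv.Perm (Fin n) :=
  if h : IsPerm n F.val then h.toPerm else 1

theorem Forest.perm_eq (F : Forest) : F.perm F.size = F.isPerm.toPerm := dif_pos F.isPerm

theorem shallowPersymmetric231Count_eq (n : ℕ) :
    shallowPersymmetric231Count n = Set.ncard
      {x : List (List Limb) | (x.map treeSize).sum = n ∧ (x.map treeMirror).reverse = x} := by
  have hinj : Function.Injective (Forest.build (Forest.build Limb.forest)) :=
    Forest.build_injective (Forest.build_injective Limb.forest_injective)
  unfold shallowPersymmetric231Count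
  -- Injectivity is needed only on lists of total size `n`; elsewhere `Forest.perm` may take its
  -- default value `1`.
  rw [← Set.InjOn.ncard_image
    (f := fun x => (Forest.build (Forest.build Limb.forest) x).perm n)]
  · congr 1
    ext π
    simp only [Set.mem_ofPred_eq, Set.mem_image]
    constructor
    · rintro ⟨h1, h2, h3⟩
      set f : ℕ → ℕ := fun i => if h : i < n then π ⟨i, h⟩ else 0 with hf
      have hfi : ∀ i : Fin n, f i = π i := fun i => by simp [hf]
      have hp : IsPerm n f := by
        constructor
        · intro i hi
          rw [hfi ⟨i, hi⟩]
          exact (π _).2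
        · intro i hi j hj hij
          rw [hfi ⟨i, hi⟩, hfi ⟨j, hj⟩] at hij
          exact congrArg Fin.val (π.injective (Fin.ext hij))
      obtain ⟨F, hs, hF⟩ := Forest.exists_of_avoids n f hp fun i j k hij hjk hk hcon => by
        refine h2 ⟨⟨i, by omega⟩, ⟨j, by omega⟩, ⟨k, hk⟩, hij, hjk, ?_, ?_⟩
        · rw [Fin.lt_def, ← hfi, ← hfi]
          exact hcon.1
        · rw [Fin.lt_def, ← hfi, ← hfi]
          exact hcon.2
      subst hs
      have hπ : F.isPerm.toPerm = π := by
        ext i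
        rw [IsPerm.toPerm_val, hF i i.2, hfi]
      rw [← hπ] at h1 h3
      obtain ⟨x, rfl⟩ := (Forest.defect_eq_zero_iff F).1 (F.isPerm.isShallow_iff.1 h1)
      refine ⟨x, ⟨(size_build_trees x).symm, hinj ?_⟩, by rw [Forest.perm_eq, hπ]⟩
      rw [← mirror_build_trees, Forest.mirror_eq_iff]
      intro i hi
      have := (isPersymmetric_iff _).1 h3 ⟨i, hi⟩
      simpa [Fin.val_rev, Nat.sub_sub, add_comm] using this
    · rintro ⟨x, ⟨hx, hm⟩, rfl⟩
      set F := Forest.build (Forest.build Limb.forest) x with hF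
      obtain rfl : F.size = n := by rw [hF, size_build_trees, hx]
      rw [Forest.perm_eq]
      refine ⟨F.isPerm.isShallow_iff.2 ((Forest.defect_eq_zero_iff F).2 ⟨x, rfl⟩), ?_, ?_⟩
      · rintro ⟨i, j, k, hij, hjk, h1, h2⟩
        exact F.val_avoids hij hjk k.2 ⟨h1, h2⟩
      · rw [isPersymmetric_iff]
        intro i
        have := (Forest.mirror_eq_iff F).1 (by rw [hF, mirror_build_trees, hm]) i i.2
        simpa [Fin.val_rev, Nat.sub_sub, add_comm] using this
  · rintro x ⟨hx, -⟩ y ⟨hy, -⟩ hxy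
    apply hinj
    rw [← size_build_trees] at hx hy
    refine Forest.eq_of_val_eq (by omega) fun i hi => ?_
    dsimp only at hxy
    subst hx
    rw [Forest.perm_eq, Forest.perm, dif_pos (by rw [← hy]; exact Forest.isPerm _)] at hxy
    exact congrArg Fin.val (DFunLike.congr_fun hxy ⟨i, hi⟩)

end ShallowPerm

/-! ### Generating functions of sums, products, lists and palindromes -/

namespace ShallowPerm

open PowerSeries

/-- The generating function of a type by size. -/
noncomputable def gf {α : Type*} (s : α → ℕ) : PowerSeries ℚ :=
  PowerSeries.mk fun n => (Nat.card {a // s a = n} : ℚ)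

/-- There are finitely many elements of each size. -/
def FiniteFibers {α : Type*} (s : α → ℕ) : Prop := ∀ n, Finite {a // s a = n}

section GeneratingFunctions

variable {α β : Type*} {s : α → ℕ} {t : β → ℕ}

theorem FiniteFibers.of_injective (ht : FiniteFibers t) (f : α → β) (hf : Function.Injective f)
    (h : ∀ a, t (f a) = s a) : FiniteFibers s := fun n =>
  have := ht n
  Finite.of_injective (fun a : {a // s a = n} => (⟨f a, (h a).trans a.2⟩ : {b // t b = n}))
    fun _ _ hab => Subtype.ext (hf (congrArg Subtype.val hab))

theorem gf_congr (e : α ≃ β) (h : ∀ a, t (e a) = s a) : gf s = gf t := by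
  ext n
  simp only [gf, coeff_mk]
  congr 1
  exact Nat.card_congr (e.subtypeEquiv fun a => by rw [h])

theorem FiniteFibers.sum (hs : FiniteFibers s) (ht : FiniteFibers t) :
    FiniteFibers (Sum.elim s t) := fun n =>
  have _ : Finite {a // Sum.elim s t (Sum.inl a) = n} := hs n
  have _ : Finite {b // Sum.elim s t (Sum.inr b) = n} := ht n
  Finite.of_equiv _ (Equiv.subtypeSum (p := fun x : α ⊕ β => Sum.elim s t x = n)).symm

theorem gf_sum (hs : FiniteFibers s) (ht : FiniteFibers t) :
    gf (Sum.elim s t) = gf s + gf t := by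
  ext n
  have h1 : Finite {a // Sum.elim s t (Sum.inl a) = n} := hs n
  have h2 : Finite {b // Sum.elim s t (Sum.inr b) = n} := ht n
  simp only [gf, coeff_mk, map_add]
  rw [Nat.card_congr (Equiv.subtypeSum (p := fun x : α ⊕ β => Sum.elim s t x = n)), Nat.card_sum]
  push_cast
  rfl

/-- Pairs of total size `n`, split by the sizes of the components. -/
def prodFiberEquiv (s : α → ℕ) (t : β → ℕ) (n : ℕ) : {x : α × β // s x.1 + t x.2 = n} ≃
    Σ p : Finset.HasAntidiagonal.antidiagonal n, {a // s a = p.1.1} × {b // t b = p.1.2} where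
  toFun x := ⟨⟨(s x.1.1, t x.1.2), Finset.HasAntidiagonal.mem_antidiagonal.2 x.2⟩, ⟨x.1.1, rfl⟩, ⟨x.1.2, rfl⟩⟩
  invFun y := ⟨(y.2.1.1, y.2.2.1), by
    rw [y.2.1.2, y.2.2.2]
    exact Finset.HasAntidiagonal.mem_antidiagonal.1 y.1.2⟩
  left_inv _ := rfl
  right_inv := by
    rintro ⟨⟨⟨i, j⟩, h⟩, ⟨a, ha⟩, ⟨b, hb⟩⟩
    change s a = i at ha
    change t b = j at hb
    subst ha hb
    rfl

theorem FiniteFibers.prod (hs : FiniteFibers s) (ht : FiniteFibers t) :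
    FiniteFibers fun x : α × β => s x.1 + t x.2 := fun n =>
  have := hs
  have := ht
  have (p : Finset.HasAntidiagonal.antidiagonal n) : Finite ({a // s a = p.1.1} × {b // t b = p.1.2}) :=
    have := hs p.1.1
    have := ht p.1.2
    inferInstance
  Finite.of_equiv _ (prodFiberEquiv s t n).symm

theorem gf_prod (hs : FiniteFibers s) (ht : FiniteFibers t) :
    gf (fun x : α × β => s x.1 + t x.2) = gf s * gf t := by
  ext n
  have (p : Finset.HasAntidiagonal.antidiagonal n) : Finite ({a // s a = p.1.1} × {b // t b = p.1.2}) :=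
    have := hs p.1.1
    have := ht p.1.2
    inferInstance
  simp only [gf, coeff_mk, coeff_mul]
  rw [Nat.card_congr (prodFiberEquiv s t n), Nat.card_sigma,
    ← Finset.sum_coe_sort (Finset.HasAntidiagonal.antidiagonal n)]
  push_cast [Nat.card_prod]
  rfl

theorem finiteFibers_unit (n : ℕ) : FiniteFibers fun _ : Unit => n := fun _ => inferInstance

theorem gf_unit (n : ℕ) : gf (fun _ : Unit => n) = X ^ n := by
  ext k
  simp only [gf, coeff_mk, coeff_X_pow]
  split_ifs with h
  · subst h
    simp
  · have : IsEmpty {_a : Unit // n = k} := ⟨fun a => h a.2.symm⟩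
    simp

theorem FiniteFibers.add_const (hs : FiniteFibers s) (c : ℕ) : FiniteFibers fun a => s a + c :=
  (hs.prod (finiteFibers_unit c)).of_injective (fun a => (a, ())) (fun a b h => by simpa using h)
    fun _ => rfl

theorem gf_add_const (hs : FiniteFibers s) (c : ℕ) : gf (fun a => s a + c) = gf s * X ^ c := by
  rw [← gf_unit, ← gf_prod hs (finiteFibers_unit c)]
  exact gf_congr (Equiv.prodPUnit α).symm fun _ => rfl

theorem FiniteFibers.mul_left (hs : FiniteFibers s) {c : ℕ} (hc : 0 < c) :
    FiniteFibers fun a => c * s a := by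
  intro n
  have := hs (n / c)
  exact Finite.of_injective
    (fun a : {a // c * s a = n} => (⟨a, (Nat.div_eq_of_eq_mul_right hc a.2.symm).symm⟩ :
      {a // s a = n / c})) fun a b h => Subtype.ext (by simpa using h)

theorem finiteFibers_nat : FiniteFibers fun m : ℕ => m := fun n =>
  inferInstanceAs (Finite {m : ℕ // m = n})

theorem gf_nat {c : ℕ} (hc : 0 < c) : gf (fun m : ℕ => c * m) * (1 - X ^ c) = 1 := by
  have hf : FiniteFibers fun m : ℕ => c * m := finiteFibers_nat.mul_left hc
  have h : gf (fun m : ℕ => c * m) = gf (fun m : ℕ => c * m) * X ^ c + 1 := by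
    conv_lhs => rw [← gf_congr (s := Sum.elim (fun m : ℕ => c * m + c) fun _ : Unit => 0)
      Equiv.natSumPUnitEquivNat (by
        rintro (m | m)
        · exact Nat.mul_succ c m
        · rfl)]
    rw [gf_sum (hf.add_const c) (finiteFibers_unit 0), gf_add_const hf, gf_unit, pow_zero]
  linear_combination h

/-- As letters have positive size, a list of total size `n` has length at most `n` and letters from
the finite set of size at most `n`. -/
theorem FiniteFibers.list (hs : FiniteFibers s) (hpos : ∀ a, 0 < s a) :
    FiniteFibers fun l : List α => (l.map s).sum := by
  intro n
  have hS : Finite {a // s a ≤ n} := by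
    have h : (⋃ k ∈ {k : ℕ | k ≤ n}, {a | s a = k}).Finite :=
      (Set.finite_le_nat n).biUnion fun k _ => @Set.toFinite _ _ (hs k)
    exact (h.subset fun a ha => Set.mem_biUnion (x := s a) ha rfl).to_subtype
  have hle : ∀ l : List α, l.length ≤ (l.map s).sum ∧ ∀ a ∈ l, s a ≤ (l.map s).sum := by
    intro l
    induction l with
    | nil => simp
    | cons a l ih =>
      have := hpos a
      simp only [List.length_cons, List.map_cons, List.sum_cons, List.mem_cons, forall_eq_or_imp]
      refine ⟨by omega, by omega, fun b hb => ?_⟩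
      have := ih.2 b hb
      omega
  have hfin : {l : List {a // s a ≤ n} | l.length ≤ n}.Finite := List.finite_length_le _ n
  refine (((hfin.image (List.map Subtype.val)).subset ?_ :
    Set.Finite {l : List α | (l.map s).sum = n})).to_subtype
  intro l hl
  have hl : (l.map s).sum = n := hl
  have h := hle l
  rw [hl] at h
  refine ⟨l.attach.map fun a => ⟨a.1, h.2 a.1 a.2⟩, ?_, ?_⟩
  · simpa using h.1
  · simp [Function.comp_def]

/-- A list is empty or has a head and a tail. -/
def listEquiv (α : Type*) : List α ≃ Unit ⊕ α × List α where
  toFun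
    | [] => Sum.inl ()
    | a :: l => Sum.inr (a, l)
  invFun
    | Sum.inl _ => []
    | Sum.inr (a, l) => a :: l
  left_inv l := by cases l <;> rfl
  right_inv x := by rcases x with _ | ⟨_, _⟩ <;> rfl

theorem gf_list (hs : FiniteFibers s) (hpos : ∀ a, 0 < s a) :
    gf (fun l : List α => (l.map s).sum) * (1 - gf s) = 1 := by
  have hf := hs.list hpos
  have h : gf (fun l : List α => (l.map s).sum) =
      1 + gf s * gf (fun l : List α => (l.map s).sum) := by
    conv_lhs => rw [gf_congr (t := Sum.elim (fun _ : Unit => 0)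
      fun x : α × List α => s x.1 + (x.2.map s).sum) (listEquiv α) (by
        rintro (_ | ⟨a, l⟩) <;> simp [listEquiv])]
    rw [gf_sum (finiteFibers_unit 0) (hs.prod hf), gf_unit, gf_prod hs hf, pow_zero]
  linear_combination h

/-- Lists that are palindromic up to an involution of the letters. -/
abbrev Pal (m : α → α) : Type _ := {l : List α // (l.map m).reverse = l}

/-- The palindromic list with given outer letters and interior. -/
def palCons {m : α → α} (hm : Function.Involutive m) :
    Unit ⊕ ({a // m a = a} ⊕ α × Pal m) → Pal m
  | Sum.inl _ => ⟨[], rfl⟩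
  | Sum.inr (Sum.inl a) => ⟨[a.1], by simp [a.2]⟩
  | Sum.inr (Sum.inr (a, l)) => ⟨a :: (l.1 ++ [m a]), by simp [hm a, l.2]⟩

theorem palCons_bijective {m : α → α} (hm : Function.Involutive m) :
    Function.Bijective (palCons hm) := by
  constructor
  · rintro (_ | a | ⟨a, l⟩) (_ | b | ⟨b, l'⟩) h <;> replace h := congrArg Subtype.val h <;>
      simp [palCons] at h
    · rfl
    · rw [Subtype.ext h]
    · obtain ⟨rfl, h⟩ := h
      rw [Subtype.ext h.1]
  · rintro ⟨l, hl⟩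
    rcases l with _ | ⟨a, l⟩
    · exact ⟨Sum.inl (), rfl⟩
    · rcases List.eq_nil_or_concat l with rfl | ⟨l, b, rfl⟩
      · exact ⟨Sum.inr (Sum.inl ⟨a, by simpa using hl⟩), rfl⟩
      · simp only [List.concat_eq_append, List.map_cons, List.map_append, List.map_nil,
          List.reverse_cons, List.reverse_append, List.reverse_nil, List.nil_append,
          List.cons_append, List.cons.injEq] at hl
        obtain ⟨h1, h2⟩ := hl
        have h3 := List.append_inj' h2 rfl
        refine ⟨Sum.inr (Sum.inr (a, ⟨l, h3.1⟩)), ?_⟩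
        have h4 : m a = b := by simpa using h3.2
        simp [palCons, h4]

/-- A nonempty palindrome is one fixed letter, or a shorter palindrome between `a` and `m a`. The
outer pair has size `2 * s a`, as `m` preserves size. -/
theorem gf_pal {m : α → α} (hm : Function.Involutive m) (hsm : ∀ a, s (m a) = s a)
    (hs : FiniteFibers s) (hpos : ∀ a, 0 < s a) :
    gf (fun l : Pal m => (l.1.map s).sum) * (1 - gf fun a => 2 * s a) =
      1 + gf fun a : {a // m a = a} => s a := by
  have hf : FiniteFibers fun l : Pal m => (l.1.map s).sum :=
    (hs.list hpos).of_injective Subtype.val Subtype.val_injective fun _ => rfl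
  have hfix : FiniteFibers fun a : {a // m a = a} => s a :=
    hs.of_injective Subtype.val Subtype.val_injective fun _ => rfl
  have h2 := hs.mul_left two_pos
  have h : gf (fun l : Pal m => (l.1.map s).sum) =
      1 + ((gf fun a : {a // m a = a} => s a) +
        (gf fun a => 2 * s a) * gf (fun l : Pal m => (l.1.map s).sum)) := by
    conv_lhs => rw [← gf_congr (s := Sum.elim (fun _ : Unit => 0)
      (Sum.elim (fun a : {a // m a = a} => s a)
        fun x : α × Pal m => 2 * s x.1 + (x.2.1.map s).sum))
      (Equiv.ofBijective _ (palCons_bijective hm)) (by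
        rintro (_ | a | ⟨a, l⟩) <;> simp [palCons, hsm]
        omega)]
    rw [gf_sum (finiteFibers_unit 0) (hfix.sum (h2.prod hf)), gf_unit, gf_sum hfix (h2.prod hf),
      gf_prod h2 hf, pow_zero]
  linear_combination h

end GeneratingFunctions

end ShallowPerm

/-! ### Series of limbs and trees, and the final elimination -/

namespace ShallowPerm

open PowerSeries

namespace Limb

theorem mirror_involutive : Function.Involutive mirror := by
  rintro (m | ⟨i, k, j, h⟩) <;> rfl

theorem size_mirror (l : Limb) : l.mirror.size = l.size := by
  cases l
  · rfl
  · simp only [mirror, size]; omega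

theorem size_pos (l : Limb) : 0 < l.size := by cases l <;> simp [size]

/-- The limbs, sorted by the first parameter that vanishes. -/
def ofParams : ℕ ⊕ (ℕ × ℕ ⊕ (ℕ × ℕ ⊕ ℕ × ℕ)) → Limb
  | Sum.inl m => path m
  | Sum.inr (Sum.inl (k, j)) => fork 0 k j (Or.inl rfl)
  | Sum.inr (Sum.inr (Sum.inl (i, j))) => fork (i + 1) 0 j (Or.inr (Or.inl rfl))
  | Sum.inr (Sum.inr (Sum.inr (i, k))) => fork (i + 1) (k + 1) 0 (Or.inr (Or.inr rfl))

theorem ofParams_bijective : Function.Bijective ofParams := by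
  constructor
  · rintro (m | ⟨k, j⟩ | ⟨i, j⟩ | ⟨i, k⟩) (m' | ⟨k', j'⟩ | ⟨i', j'⟩ | ⟨i', k'⟩) h <;>
      simp_all [ofParams]
  · rintro (m | ⟨_ | i, k, j, h⟩)
    · exact ⟨Sum.inl m, rfl⟩
    · exact ⟨Sum.inr (Sum.inl (k, j)), rfl⟩
    · rcases k with _ | k
      · exact ⟨Sum.inr (Sum.inr (Sum.inl (i, j))), rfl⟩
      · obtain rfl : j = 0 := by omega
        exact ⟨Sum.inr (Sum.inr (Sum.inr (i, k))), rfl⟩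

/-- The limbs that are their own mirror images. -/
def symmOfParams : ℕ ⊕ (ℕ ⊕ ℕ) → {l : Limb // l.mirror = l}
  | Sum.inl m => ⟨path m, rfl⟩
  | Sum.inr (Sum.inl k) => ⟨fork 0 k k (Or.inl rfl), rfl⟩
  | Sum.inr (Sum.inr i) => ⟨fork (i + 1) 0 0 (Or.inr (Or.inl rfl)), rfl⟩

theorem symmOfParams_bijective : Function.Bijective symmOfParams := by
  constructor
  · rintro (m | k | i) (m' | k' | i') h <;>
      replace h := congrArg Subtype.val h <;> simp_all [symmOfParams]
  · rintro ⟨m | ⟨_ | i, k, j, h⟩, hl⟩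
    · exact ⟨Sum.inl m, rfl⟩
    · simp only [mirror, fork.injEq, true_and] at hl
      obtain ⟨rfl, -⟩ := hl
      exact ⟨Sum.inr (Sum.inl j), rfl⟩
    · simp only [mirror, fork.injEq, true_and] at hl
      obtain ⟨rfl, -⟩ := hl
      obtain rfl : j = 0 := by omega
      exact ⟨Sum.inr (Sum.inr i), rfl⟩

theorem finiteFibers_mul_nat {c : ℕ} (hc : 0 < c) : FiniteFibers fun m : ℕ => c * m :=
  finiteFibers_nat.mul_left hc

/-- Multiplying sizes by `c` stands for the substitution of `X ^ c`. The offsets 3, 4, 5 are the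
least sizes of the three fork families in `ofParams`. -/
theorem gf_mul_size {c : ℕ} (hc : 0 < c) :
    gf (fun l : Limb => c * l.size) = gf (fun m : ℕ => c * m) * X ^ c +
      gf (fun m : ℕ => c * m) ^ 2 * (X ^ (c * 3) + X ^ (c * 4) + X ^ (c * 5)) := by
  have h1 := finiteFibers_mul_nat hc
  have h2 := h1.prod h1
  rw [← gf_congr (s := Sum.elim (fun m : ℕ => c * m + c) (Sum.elim
      (fun x : ℕ × ℕ => c * x.1 + c * x.2 + c * 3) (Sum.elim
      (fun x : ℕ × ℕ => c * x.1 + c * x.2 + c * 4) fun x : ℕ × ℕ => c * x.1 + c * x.2 + c * 5)))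
    (Equiv.ofBijective _ ofParams_bijective) (by
      rintro (m | ⟨k, j⟩ | ⟨i, j⟩ | ⟨i, k⟩) <;> simp [ofParams, size] <;> ring),
    gf_sum (h1.add_const _) ((h2.add_const _).sum ((h2.add_const _).sum (h2.add_const _))),
    gf_sum (h2.add_const _) ((h2.add_const _).sum (h2.add_const _)),
    gf_sum (h2.add_const _) (h2.add_const _), gf_add_const h1, gf_add_const h2, gf_add_const h2,
    gf_add_const h2, gf_prod h1 h1]
  ring

/-- Mirroring swaps `k` and `j`. A symmetric fork thus has `k = j`, and either the stem parameter
vanishes or both paths have parameter `0`. -/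
theorem gf_symm_size :
    (gf fun l : {l : Limb // l.mirror = l} => l.1.size) =
      gf (fun m : ℕ => 1 * m) * X + gf (fun m : ℕ => 2 * m) * X ^ 3 +
        gf (fun m : ℕ => 1 * m) * X ^ 4 := by
  have h1 := finiteFibers_mul_nat one_pos
  have h2 := finiteFibers_mul_nat two_pos
  rw [← gf_congr (s := Sum.elim (fun m : ℕ => 1 * m + 1) (Sum.elim
      (fun m : ℕ => 2 * m + 3) fun m : ℕ => 1 * m + 4))
    (Equiv.ofBijective _ symmOfParams_bijective) (by
      rintro (m | k | i) <;> simp [symmOfParams, size]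
      ring),
    gf_sum (h1.add_const _) ((h2.add_const _).sum (h1.add_const _)),
    gf_sum (h2.add_const _) (h1.add_const _), gf_add_const h1, gf_add_const h2, gf_add_const h1]
  ring

theorem finiteFibers_size : FiniteFibers size := by
  intro n
  have h1 := finiteFibers_nat
  have h2 := h1.prod h1
  have := (h1.add_const 1).sum ((h2.add_const 3).sum ((h2.add_const 4).sum (h2.add_const 5)))
  have h := this.of_injective (s := size) (Equiv.ofBijective _ ofParams_bijective).symm
    (Equiv.injective _) (by
      intro l
      obtain ⟨x, rfl⟩ := (Equiv.ofBijective _ ofParams_bijective).surjective l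
      rw [Equiv.symm_apply_apply]
      rcases x with m | ⟨k, j⟩ | ⟨i, j⟩ | ⟨i, k⟩ <;> simp [ofParams, size]
      all_goals omega)
  exact h n

end Limb

theorem treeMirror_involutive : Function.Involutive treeMirror := by
  intro l
  simp [treeMirror, Limb.mirror_involutive.comp_self]

theorem treeSize_treeMirror (l : List Limb) : treeSize (treeMirror l) = treeSize l := by
  have : Limb.size ∘ Limb.mirror = Limb.size := funext Limb.size_mirror
  simp [treeSize, treeMirror, List.sum_reverse, this]

theorem finiteFibers_treeSize : FiniteFibers treeSize :=
  (Limb.finiteFibers_size.list Limb.size_pos).add_const 1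

theorem shallowPersymmetric231GF_eq :
    shallowPersymmetric231GF = gf fun x : Pal treeMirror => (x.1.map treeSize).sum := by
  ext n
  simp only [shallowPersymmetric231GF, gf, coeff_mk]
  rw [shallowPersymmetric231Count_eq]
  congr 1
  refine Nat.card_congr (β := {x : Pal treeMirror // (x.1.map treeSize).sum = n})
    ⟨fun x => ⟨⟨x.1, x.2.2⟩, x.2.1⟩, fun x => ⟨x.1.1, x.2, x.1.2⟩, fun _ => rfl, fun _ => rfl⟩

theorem gf_two_mul_treeSize :
    (gf fun l => 2 * treeSize l) * (1 - gf fun l : Limb => 2 * l.size) = X ^ 2 := by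
  have hf := Limb.finiteFibers_size.mul_left two_pos
  have hpos : ∀ l : Limb, 0 < 2 * l.size := fun l => by have := l.size_pos; omega
  have h := gf_list hf hpos
  have h2 : (gf fun l => 2 * treeSize l) =
      (gf fun l : List Limb => (l.map fun a => 2 * a.size).sum) * X ^ 2 := by
    rw [← gf_add_const (hf.list hpos)]
    refine gf_congr (Equiv.refl _) fun l => ?_
    simp [treeSize, List.sum_map_mul_left, mul_add]
  rw [h2]
  linear_combination X ^ 2 * h

theorem gf_symm_treeSize :
    (gf fun l : {l // treeMirror l = l} => treeSize l) *
      (1 - gf fun l : Limb => 2 * l.size) =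
        X * (1 + gf fun l : {l : Limb // l.mirror = l} => l.1.size) := by
  have h := gf_pal Limb.mirror_involutive Limb.size_mirror Limb.finiteFibers_size Limb.size_pos
  have hf : FiniteFibers fun l : Pal Limb.mirror => (l.1.map Limb.size).sum :=
    (Limb.finiteFibers_size.list Limb.size_pos).of_injective Subtype.val Subtype.val_injective
      fun _ => rfl
  have h2 := gf_add_const hf 1
  change (gf fun l : {l // treeMirror l = l} => treeSize l) = _ at h2
  rw [h2]
  linear_combination X * h

end ShallowPerm

open ShallowPerm in
theorem generatingFunction_mul_denominator :
    shallowPersymmetric231GF *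
        (PowerSeries.X ^ 10 + PowerSeries.X ^ 8 + 2 * PowerSeries.X ^ 6
          - 4 * PowerSeries.X ^ 4 + 4 * PowerSeries.X ^ 2 - 1 : PowerSeries ℚ) =
      PowerSeries.X ^ 10 + 2 * PowerSeries.X ^ 8 + PowerSeries.X ^ 7 + PowerSeries.X ^ 6
          - PowerSeries.X ^ 5 - 2 * PowerSeries.X ^ 4 + PowerSeries.X ^ 3
          + 2 * PowerSeries.X ^ 2 - PowerSeries.X - 1 := by
  have hP := gf_pal treeMirror_involutive treeSize_treeMirror finiteFibers_treeSize
    fun l => Nat.succ_pos _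
  rw [← shallowPersymmetric231GF_eq] at hP
  have hA := gf_two_mul_treeSize
  have hQ := gf_symm_treeSize
  have hC := Limb.gf_mul_size two_pos
  have hE := Limb.gf_symm_size
  have hN := gf_nat two_pos
  have hM := gf_nat one_pos
  norm_num only at hC
  rw [pow_one] at hM
  set P := shallowPersymmetric231GF
  set A := gf fun l => 2 * treeSize l
  set Q := gf fun l : {l // treeMirror l = l} => treeSize l
  set C := gf fun l : Limb => 2 * l.size
  set E := gf fun l : {l : Limb // l.mirror = l} => l.1.size
  set N := gf fun m : ℕ => 2 * m
  set M := gf fun m : ℕ => 1 * m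
  set x : PowerSeries ℚ := PowerSeries.X
  -- The factor `(1 - x ^ 2) ^ 2` clears the geometric series in `C`, and below also those in `E`.
  have hCu : (1 - C) * (1 - x ^ 2) ^ 2 = 1 - 3 * x ^ 2 + 2 * x ^ 4 - x ^ 6 - x ^ 8 - x ^ 10 := by
    rw [hC]
    linear_combination (-x ^ 2 * (1 - x ^ 2)
      - (x ^ 6 + x ^ 8 + x ^ 10) * (N * (1 - x ^ 2) + 1)) * hN
  have hEu : (1 + E) * (1 - x ^ 2) ^ 2 = 1 + x - x ^ 2 + x ^ 4 - x ^ 6 - x ^ 7 := by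
    rw [hE]
    linear_combination (x + x ^ 4) * (1 + x) * (1 - x ^ 2) * hM + x ^ 3 * (1 - x ^ 2) * hN
  -- Eliminating `A` and `Q` gives `P * (1 - C - x ^ 2) = 1 - C + x * (1 + E)`. The sign is reversed
  -- because the stated denominator has constant term `-1`.
  linear_combination (-(1 - C) * (1 - x ^ 2) ^ 2) * hP - P * (1 - x ^ 2) ^ 2 * hA
    - (1 - x ^ 2) ^ 2 * hQ + (P - 1) * hCu - x * hEu

theorem mainTheorem10 :
    ShallowPerm.shallowPersymmetric231GF =
      ((PowerSeries.X ^ 10 + 2 * PowerSeries.X ^ 8 + PowerSeries.X ^ 7 + PowerSeries.X ^ 6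
          - PowerSeries.X ^ 5 - 2 * PowerSeries.X ^ 4 + PowerSeries.X ^ 3
          + 2 * PowerSeries.X ^ 2 - PowerSeries.X - 1 : PowerSeries ℚ)) *
        (PowerSeries.X ^ 10 + PowerSeries.X ^ 8 + 2 * PowerSeries.X ^ 6
          - 4 * PowerSeries.X ^ 4 + 4 * PowerSeries.X ^ 2 - 1 : PowerSeries ℚ)⁻¹ := by
  rw [PowerSeries.eq_mul_inv_iff_mul_eq (by simp)]
  exact generatingFunction_mul_denominator
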